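/- Let $p,q\ge 0$, let $\phi_1,\dots,\phi_p,\theta_1,\dots,\theta_q\in\mathbb R$, let $\{\xi_t\}_{t\in\mathbb Z}$ be i.i.d. real random variables, and let $\{X_t\}_{t\in\mathbb Z}$ be an ARMA$(p,q)$ process with excitation noise $\{\xi_t\}$, i.e. for every $t\in\mathbb Z$, almost surely, $$X_t=\sum_{i=1}^p\phi_iX_{t-i}+\xi_t+\sum_{i=1}^q\theta_i\xi_{t-i}.$$ (Neither stationarity nor causality is required.) For $k\ge1$ write $[x]_k=\lfloor kx\rfloor/k$, componentwise for vectors, let $H$ denote Shannon entropy with values in $[0,\infty]$, and let $X^n=(X_1,\dots,X_n)$. Assume that $H([X_t]_1)<\infty$ for all $t$, and let $\alpha\in[0,\infty)$ be such that * $\xi_0$ has Rényi information dimension $d(\xi_0)=\lim_{k\to\infty}H([\xi_0]_k)/\log k=\alpha$, or * $H([\xi_0]_1)<\infty$ and $\xi_0$ is discrete-continuous with continuity chance $\alpha\in[0,1]$, i.e. its law is $(1-\alpha)\nu_d+\alpha\nu_c$ with a discrete probability measure $\nu_d$ and an absolutely continuous probability measure $\nu_c$ on $\mathbb R$. Then the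 block-average information dimension $d_B(\{X_t\})=\lim_{n\to\infty}\frac1n d(X^n)$ and the information dimension rate $d_I(\{X_t\})=\lim_{k\to\infty}\frac1{\log k}\lim_{n\to\infty}\frac1nH([X^n]_k)$ satisfy $$d_I(\{X_t\})=d_B(\{X_t\})=\alpha .$$ More precisely, $$\lim_{n\to\infty}\frac1n\limsup_{k\to\infty}\frac{H([X^n]_k)}{\log k}=\lim_{n\to\infty}\frac1n\liminf_{k\to\infty}\frac{H([X^n]_k)}{\log k}=\alpha,$$ $$\lim_{k\to\infty}\frac1{\log k}\limsup_{n\to\infty}\frac{H([X^n]_k)}{n}=\lim_{k\to\infty}\frac1{\log k}\liminf_{n\to\infty}\frac{H([X^n]_k)}{n}=\alpha,$$ and if $\{X_t\}$ is strictly stationary, then the entropy rate $\lim_{n\to\infty}\frac1nH([X^n]_k)$ exists and is finite for every $k\ge1$. -/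

import Mathlib

open MeasureTheory ProbabilityTheory Filter
open scoped ENNReal NNReal Topology

noncomputable section

/-- Shannon entropy `∑ₛ -P(Z = s) log P(Z = s)` (in nats) of a discrete random variable `Z`,
with values in `[0, ∞]`. -/
def shannonEntropy {Ω S : Type*} [MeasurableSpace Ω] (μ : Measure Ω) (Z : Ω → S) : ℝ≥0∞ :=
  ∑' s : S, ENNReal.ofReal (Real.negMulLog (μ.real (Z ⁻¹' {s})))

/-- The uniform quantization `[x]_k = ⌊k x⌋ / k`. -/
def quantize (k : ℕ) (x : ℝ) : ℝ := (⌊(k : ℝ) * x⌋ : ℝ) / (k : ℝ)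

/-- `H([Y]_k)` for a real random variable `Y`. -/
def quantEntropy {Ω : Type*} [MeasurableSpace Ω] (μ : Measure Ω) (Y : Ω → ℝ) (k : ℕ) : ℝ≥0∞ :=
  shannonEntropy μ (fun ω => quantize k (Y ω))

/-- `H([X_1]_k, …, [X_n]_k)` for a process `(X_t)`, indexed by `t ∈ ℤ`. -/
def blockEntropy {Ω : Type*} [MeasurableSpace Ω] (μ : Measure Ω) (X : ℤ → Ω → ℝ) (n k : ℕ) :
    ℝ≥0∞ :=
  shannonEntropy μ (fun ω => fun i : Fin n => quantize k (X ((i : ℤ) + 1) ω))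

/-- The Rényi information dimension `lim_k H([Y]_k) / log k` of `Y` exists and equals `d`. -/
def HasInfoDim {Ω : Type*} [MeasurableSpace Ω] (μ : Measure Ω) (Y : Ω → ℝ) (d : ℝ≥0) : Prop :=
  Tendsto (fun k : ℕ => quantEntropy μ Y k / ENNReal.ofReal (Real.log k)) atTop
    (𝓝 (d : ℝ≥0∞))

/-- Upper Rényi information dimension of the random vector `(X_1, …, X_n)`. -/
def upperBlockInfoDim {Ω : Type*} [MeasurableSpace Ω] (μ : Measure Ω) (X : ℤ → Ω → ℝ) (n : ℕ) :
    ℝ≥0∞ :=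
  limsup (fun k : ℕ => blockEntropy μ X n k / ENNReal.ofReal (Real.log k)) atTop

/-- Lower Rényi information dimension of the random vector `(X_1, …, X_n)`. -/
def lowerBlockInfoDim {Ω : Type*} [MeasurableSpace Ω] (μ : Measure Ω) (X : ℤ → Ω → ℝ) (n : ℕ) :
    ℝ≥0∞ :=
  liminf (fun k : ℕ => blockEntropy μ X n k / ENNReal.ofReal (Real.log k)) atTop

/-- The block-average information dimension `d_B = lim_n d(X_1, …, X_n) / n` equals `d`.
As the limit in `k` that defines `d(X_1, …, X_n)` need not exist for each `n`, this is required
both with the upper and with the lower information dimension of the blocks. -/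
def HasBlockAverageInfoDim {Ω : Type*} [MeasurableSpace Ω] (μ : Measure Ω) (X : ℤ → Ω → ℝ)
    (d : ℝ≥0) : Prop :=
  Tendsto (fun n : ℕ => upperBlockInfoDim μ X n / (n : ℝ≥0∞)) atTop (𝓝 (d : ℝ≥0∞)) ∧
  Tendsto (fun n : ℕ => lowerBlockInfoDim μ X n / (n : ℝ≥0∞)) atTop (𝓝 (d : ℝ≥0∞))

/-- Upper entropy rate of the quantized process `([X_t]_k)`. -/
def upperEntropyRate {Ω : Type*} [MeasurableSpace Ω] (μ : Measure Ω) (X : ℤ → Ω → ℝ) (k : ℕ) :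
    ℝ≥0∞ :=
  limsup (fun n : ℕ => blockEntropy μ X n k / (n : ℝ≥0∞)) atTop

/-- Lower entropy rate of the quantized process `([X_t]_k)`. -/
def lowerEntropyRate {Ω : Type*} [MeasurableSpace Ω] (μ : Measure Ω) (X : ℤ → Ω → ℝ) (k : ℕ) :
    ℝ≥0∞ :=
  liminf (fun n : ℕ => blockEntropy μ X n k / (n : ℝ≥0∞)) atTop

/-- The information dimension rate `d_I = lim_k (1 / log k) lim_n H([X_1]_k, …, [X_n]_k) / n`
equals `d`. The inner limit (the entropy rate) exists for a stationary process; in general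
this is required both with the upper and with the lower entropy rate. -/
def HasInfoDimRate {Ω : Type*} [MeasurableSpace Ω] (μ : Measure Ω) (X : ℤ → Ω → ℝ)
    (d : ℝ≥0) : Prop :=
  Tendsto (fun k : ℕ => upperEntropyRate μ X k / ENNReal.ofReal (Real.log k)) atTop
    (𝓝 (d : ℝ≥0∞)) ∧
  Tendsto (fun k : ℕ => lowerEntropyRate μ X k / ENNReal.ofReal (Real.log k)) atTop
    (𝓝 (d : ℝ≥0∞))

/-- Strict stationarity. -/
def IsStrictlyStationary {Ω : Type*} [MeasurableSpace Ω] (μ : Measure Ω) (X : ℤ → Ω → ℝ) :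
    Prop :=
  ∀ s : ℤ, IdentDistrib (fun ω => fun t : ℤ => X (t + s) ω) (fun ω => fun t : ℤ => X t ω) μ μ

/-- A probability law on `ℝ` is discrete-continuous with continuity chance `α`: it is the mixture
`(1 - α) · (discrete) + α · (absolutely continuous)`. -/
def IsDiscreteContinuous (ν : Measure ℝ) (α : ℝ≥0) : Prop :=
  α ≤ 1 ∧ ∃ νd νc : Measure ℝ, IsProbabilityMeasure νd ∧ IsProbabilityMeasure νc ∧
    (∃ S : Set ℝ, S.Countable ∧ νd Sᶜ = 0) ∧ νc ≪ volume ∧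
    ν = (1 - α) • νd + α • νc

/-- `(X_t)` is an ARMA(p, q) process with coefficients `φ`, `θ` and i.i.d. excitation noise `(ξ_t)`:
`X_t = ∑_{i=1}^p φ_i X_{t-i} + ξ_t + ∑_{i=1}^q θ_i ξ_{t-i}` for every `t`, almost surely.
The coefficients are indexed from `0`, so that `φ i` stands for `φ_{i+1}`. -/
structure IsARMA {Ω : Type*} [MeasurableSpace Ω] (μ : Measure Ω) {p q : ℕ}
    (φ : Fin p → ℝ) (θ : Fin q → ℝ) (ξ X : ℤ → Ω → ℝ) : Prop where
  measurable_noise : ∀ t, Measurable (ξ t)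
  measurable_process : ∀ t, Measurable (X t)
  indep_noise : iIndepFun ξ μ
  identDistrib_noise : ∀ t, IdentDistrib (ξ t) (ξ 0) μ μ
  recursion : ∀ t : ℤ, ∀ᵐ ω ∂μ,
    X t ω = ∑ i : Fin p, φ i * X (t - ((i : ℤ) + 1)) ω + ξ t ω
      + ∑ i : Fin q, θ i * ξ (t - ((i : ℤ) + 1)) ω

end

/-! ### Shannon entropy on countable alphabets, for measures of mass at most one. -/

section Entropy

variable {Ω S T : Type*} [MeasurableSpace Ω] {μ : Measure Ω}

/-! Rounding each term of the ARMA equation, scaled by `k`, moves its right side by at most a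
constant depending only on the coefficients. So the integers `⌊k X_t⌋` obey a recursion driven by
`⌊k ξ_t⌋` up to an integer error in a fixed finite set, and a block of length `n` is a function of
`p` past values of `X`, `q` past values of `ξ`, the noise block and `n` such errors. Solved for
`ξ_t`, the equation is a recursion of the same type with the roles of `X` and `ξ` exchanged, so the
comparison works in both directions without causality or invertibility.

Since entropy is subadditive, and additive for the i.i.d. noise, `IsARMA.blockEntropy_bounds` shows
that `H([X^n]_k)` and `n H([ξ_0]_k)` differ by at most `n C + D + p log k + q H([ξ_0]_k)`, with `C`
and `D` independent of `n` and `k`. The finiteness of `H([X_t]_1)` enters through the past of `X`,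
whose entropy grows at most like `p log k` by `quantEntropy_le`. This uniformity permits either
order of limits: dividing by `log k` and then by `n` leaves an error `(p + q α) / n`, while the
other order leaves `C / log k`.

For discrete-continuous noise, `d(ξ_0) = α` is Rényi's theorem, obtained by splitting the law into a
well-behaved part and a part of small or controlled mass. Under stationarity the entropy rate exists
by Fekete's lemma. -/

theorem isFiniteMeasure_of_le_one (hμ : μ Set.univ ≤ 1) : IsFiniteMeasure μ :=
  ⟨hμ.trans_lt ENNReal.one_lt_top⟩

theorem measureReal_le_one_of_univ (hμ : μ Set.univ ≤ 1) (s : Set Ω) : μ.real s ≤ 1 :=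
  ENNReal.toReal_le_of_le_ofReal zero_le_one
    (by simpa using (measure_mono (Set.subset_univ s)).trans hμ)

theorem ofReal_negMulLog {x : ℝ} (hx : 0 ≤ x) :
    ENNReal.ofReal (Real.negMulLog x) = ENNReal.ofReal x * ENNReal.ofReal (-Real.log x) := by
  rw [← ENNReal.ofReal_mul hx, Real.negMulLog]
  congr 1
  ring

/-- Entropy is the mean of the information density. -/
theorem shannonEntropy_eq_lintegral [Countable S] [MeasurableSpace S]
    [MeasurableSingletonClass S] (hμ : μ Set.univ ≤ 1) {Z : Ω → S} (hZ : Measurable Z) :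
    shannonEntropy μ Z = ∫⁻ ω, ENNReal.ofReal (-Real.log (μ.real (Z ⁻¹' {Z ω}))) ∂μ := by
  have := isFiniteMeasure_of_le_one hμ
  have h : ∫⁻ ω, ENNReal.ofReal (-Real.log (μ.real (Z ⁻¹' {Z ω}))) ∂μ
      = ∫⁻ s, ENNReal.ofReal (-Real.log (μ.real (Z ⁻¹' {s}))) ∂(μ.map Z) :=
    (lintegral_map (f := fun s => ENNReal.ofReal (-Real.log (μ.real (Z ⁻¹' {s}))))
      (measurable_of_countable _) hZ).symm
  rw [h, lintegral_countable', shannonEntropy]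
  refine tsum_congr fun s => ?_
  rw [ofReal_negMulLog measureReal_nonneg, Measure.map_apply hZ (measurableSet_singleton s),
    ofReal_measureReal, mul_comm]

/-- If `Y` is determined by `Z` on a set of full measure, then `H(Y) ≤ H(Z)`. -/
theorem shannonEntropy_le_of_determined [Countable S] [MeasurableSpace S]
    [MeasurableSingletonClass S] [Countable T] [MeasurableSpace T] [MeasurableSingletonClass T]
    (hμ : μ Set.univ ≤ 1) {Z : Ω → S} (hZ : Measurable Z) {Y : Ω → T} (hY : Measurable Y)
    {G : Set Ω} (hG : ∀ᵐ ω ∂μ, ω ∈ G)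
    (h : ∀ ω ∈ G, ∀ ω' ∈ G, Z ω = Z ω' → Y ω = Y ω') :
    shannonEntropy μ Y ≤ shannonEntropy μ Z := by
  have := isFiniteMeasure_of_le_one hμ
  rw [shannonEntropy_eq_lintegral hμ hZ, shannonEntropy_eq_lintegral hμ hY]
  -- Since `Real.log 0 = 0`, comparing logarithms needs the smaller cell to have positive mass; null
  -- cells are almost surely not visited because there are countably many.
  have hpos : ∀ᵐ ω ∂μ, μ (Z ⁻¹' {Z ω}) ≠ 0 := by
    have h1 : ∀ᵐ ω ∂μ, ∀ s, μ (Z ⁻¹' {s}) = 0 → Z ω ≠ s := by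
      rw [ae_all_iff]
      intro s
      by_cases hs : μ (Z ⁻¹' {s}) = 0
      · filter_upwards [measure_eq_zero_iff_ae_notMem.1 hs] with ω hω _ hh
        exact hω hh
      · exact Eventually.of_forall fun ω h' => absurd h' hs
    filter_upwards [h1] with ω hω h0
    exact hω _ h0 rfl
  refine lintegral_mono_ae ?_
  filter_upwards [hG, hpos] with ω hω hp
  refine ENNReal.ofReal_le_ofReal (neg_le_neg (Real.log_le_log ?_ ?_))
  · exact ENNReal.toReal_pos hp (measure_ne_top _ _)
  · refine ENNReal.toReal_mono (measure_ne_top _ _) (measure_mono_ae ?_)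
    filter_upwards [hG] with ω' hω' hz
    exact h ω' hω' ω hω hz

theorem shannonEntropy_comp_le [Countable S] [MeasurableSpace S]
    [MeasurableSingletonClass S] [Countable T] [MeasurableSpace T] [MeasurableSingletonClass T]
    (hμ : μ Set.univ ≤ 1) {Z : Ω → S} (hZ : Measurable Z) {Y : Ω → T} (hY : Measurable Y)
    (h : ∀ ω ω', Z ω = Z ω' → Y ω = Y ω') :
    shannonEntropy μ Y ≤ shannonEntropy μ Z :=
  shannonEntropy_le_of_determined hμ hZ hY (G := Set.univ) (by simp) fun ω _ ω' _ => h ω ω'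

/-- Values outside the range of `f` have empty preimage and contribute nothing. No countability is
assumed, so this passes from real quantized values to integer floors, where the countable-alphabet
lemmas apply. -/
theorem shannonEntropy_comp_injective {f : S → T} (hf : Function.Injective f) (Z : Ω → S) :
    shannonEntropy μ (fun ω => f (Z ω)) = shannonEntropy μ Z := by
  unfold shannonEntropy
  rw [← hf.tsum_eq]
  · refine tsum_congr fun s => ?_
    congr 3
    ext ω
    simp [hf.eq_iff]
  · intro t ht
    by_contra hn
    refine ht ?_
    have : (fun ω => f (Z ω)) ⁻¹' {t} = ∅ := by
      ext ω
      simp only [Set.mem_preimage, Set.mem_singleton_iff, Set.mem_empty_iff_false, iff_false]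
      exact fun h => hn ⟨_, h⟩
    simp [this]

theorem shannonEntropy_congr {Ω' : Type*} [MeasurableSpace Ω'] {μ' : Measure Ω'}
    {Z : Ω → S} {Z' : Ω' → S} (h : ∀ s, μ (Z ⁻¹' {s}) = μ' (Z' ⁻¹' {s})) :
    shannonEntropy μ Z = shannonEntropy μ' Z' := by
  simp only [shannonEntropy, Measure.real, h]

theorem IdentDistrib.shannonEntropy_eq {Ω' : Type*} [MeasurableSpace Ω'] {μ' : Measure Ω'}
    [MeasurableSpace S] [MeasurableSingletonClass S] {Z : Ω → S} {Z' : Ω' → S}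
    (h : IdentDistrib Z Z' μ μ') : shannonEntropy μ Z = shannonEntropy μ' Z' :=
  shannonEntropy_congr fun s => h.measure_mem_eq (measurableSet_singleton s)

/-- `-c log c ≤ -c log a - c log b + (a b - c)`, rearranged so that all terms are nonnegative. -/
theorem negMulLog_add_le {a b c : ℝ} (ha : 0 ≤ a) (hb : 0 ≤ b) (hc : 0 ≤ c)
    (hac : a = 0 → c = 0) (hbc : b = 0 → c = 0) :
    Real.negMulLog c + c ≤ c * (-Real.log a) + c * (-Real.log b) + a * b := by
  rcases hc.eq_or_lt with rfl | hc
  · simpa using mul_nonneg ha hb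
  have ha' : 0 < a := ha.lt_of_ne fun h => hc.ne' (hac h.symm)
  have hb' : 0 < b := hb.lt_of_ne fun h => hc.ne' (hbc h.symm)
  have h := Real.log_le_sub_one_of_pos (show 0 < a * b / c by positivity)
  rw [Real.log_div (by positivity) hc.ne', Real.log_mul ha'.ne' hb'.ne'] at h
  have h2 := mul_le_mul_of_nonneg_left h hc.le
  have h3 : c * (a * b / c - 1) = a * b - c := by field_simp
  rw [h3] at h2
  unfold Real.negMulLog
  linarith

theorem tsum_ofReal_measureReal_preimage [Countable S] [MeasurableSpace S]
    [MeasurableSingletonClass S] (hμ : μ Set.univ ≤ 1) {Z : Ω → S} (hZ : Measurable Z) :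
    ∑' s, ENNReal.ofReal (μ.real (Z ⁻¹' {s})) = μ Set.univ := by
  have := isFiniteMeasure_of_le_one hμ
  have h := lintegral_countable' (μ := μ.map Z) (fun _ => (1 : ℝ≥0∞))
  rw [lintegral_one, Measure.map_apply hZ MeasurableSet.univ, Set.preimage_univ] at h
  rw [h]
  refine tsum_congr fun s => ?_
  rw [Measure.map_apply hZ (measurableSet_singleton s), ofReal_measureReal, one_mul]

theorem tsum_mul_preimage [Countable S] [MeasurableSpace S] [MeasurableSingletonClass S]
    (hμ : μ Set.univ ≤ 1) {Z : Ω → S} (hZ : Measurable Z) (g : S → ℝ≥0∞) :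
    ∑' s, ENNReal.ofReal (μ.real (Z ⁻¹' {s})) * g s = ∫⁻ ω, g (Z ω) ∂μ := by
  have := isFiniteMeasure_of_le_one hμ
  rw [← lintegral_map (measurable_of_countable g) hZ, lintegral_countable']
  refine tsum_congr fun s => ?_
  rw [Measure.map_apply hZ (measurableSet_singleton s), ofReal_measureReal, mul_comm]

/-- Subadditivity of entropy. -/
theorem shannonEntropy_prodMk_le [Countable S] [MeasurableSpace S]
    [MeasurableSingletonClass S] [Countable T] [MeasurableSpace T] [MeasurableSingletonClass T]
    (hμ : μ Set.univ ≤ 1) {Z : Ω → S} (hZ : Measurable Z) {Y : Ω → T} (hY : Measurable Y) :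
    shannonEntropy μ (fun ω => (Z ω, Y ω)) ≤ shannonEntropy μ Z + shannonEntropy μ Y := by
  have := isFiniteMeasure_of_le_one hμ
  have hZY : Measurable fun ω => (Z ω, Y ω) := hZ.prodMk hY
  set P : S × T → ℝ := fun s => μ.real ((fun ω => (Z ω, Y ω)) ⁻¹' {s}) with hP
  set a : S → ℝ := fun s => μ.real (Z ⁻¹' {s}) with ha
  set b : T → ℝ := fun s => μ.real (Y ⁻¹' {s}) with hb
  have hle1 : ∀ s, P s ≤ a s.1 := fun s => measureReal_mono (by
    rintro ω hω
    simp only [Set.mem_preimage, Set.mem_singleton_iff] at hω ⊢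
    rw [← hω])
  have hle2 : ∀ s, P s ≤ b s.2 := fun s => measureReal_mono (by
    rintro ω hω
    simp only [Set.mem_preimage, Set.mem_singleton_iff] at hω ⊢
    rw [← hω])
  have hP0 : ∀ s, 0 ≤ P s := fun s => measureReal_nonneg
  have ha0 : ∀ s, 0 ≤ a s := fun s => measureReal_nonneg
  have hb0 : ∀ s, 0 ≤ b s := fun s => measureReal_nonneg
  -- Gibbs' inequality against the product of the marginals. The mass `P s` sits on the left to
  -- avoid truncated subtraction; after summation it gives `μ univ`, which absorbs the `(μ univ)²`
  -- from the product term because `μ univ ≤ 1`.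
  have hpt : ∀ s : S × T, ENNReal.ofReal (Real.negMulLog (P s)) + ENNReal.ofReal (P s) ≤
      ENNReal.ofReal (P s) * ENNReal.ofReal (-Real.log (a s.1))
      + ENNReal.ofReal (P s) * ENNReal.ofReal (-Real.log (b s.2))
      + ENNReal.ofReal (a s.1) * ENNReal.ofReal (b s.2) := by
    intro s
    have h1 : 0 ≤ -Real.log (a s.1) :=
      neg_nonneg.2 (Real.log_nonpos (ha0 _) (measureReal_le_one_of_univ hμ _))
    have h2 : 0 ≤ -Real.log (b s.2) :=
      neg_nonneg.2 (Real.log_nonpos (hb0 _) (measureReal_le_one_of_univ hμ _))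
    rw [← ENNReal.ofReal_mul (hP0 s), ← ENNReal.ofReal_mul (hP0 s), ← ENNReal.ofReal_mul (ha0 _),
      ← ENNReal.ofReal_add (Real.negMulLog_nonneg (hP0 s) (measureReal_le_one_of_univ hμ _)) (hP0 s),
      ← ENNReal.ofReal_add (mul_nonneg (hP0 s) h1) (mul_nonneg (hP0 s) h2),
      ← ENNReal.ofReal_add (add_nonneg (mul_nonneg (hP0 s) h1) (mul_nonneg (hP0 s) h2))
        (mul_nonneg (ha0 _) (hb0 _))]
    exact ENNReal.ofReal_le_ofReal (negMulLog_add_le (ha0 _) (hb0 _) (hP0 s)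
      (fun h => le_antisymm (h ▸ hle1 s) (hP0 s)) (fun h => le_antisymm (h ▸ hle2 s) (hP0 s)))
  have hsum := ENNReal.tsum_le_tsum hpt
  rw [ENNReal.tsum_add, ENNReal.tsum_add, ENNReal.tsum_add,
    tsum_mul_preimage hμ hZY (fun s => ENNReal.ofReal (-Real.log (a s.1))),
    tsum_mul_preimage hμ hZY (fun s => ENNReal.ofReal (-Real.log (b s.2))),
    tsum_ofReal_measureReal_preimage hμ hZY, ← shannonEntropy_eq_lintegral hμ hZ,
    ← shannonEntropy_eq_lintegral hμ hY, ENNReal.tsum_prod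
      (f := fun x y => ENNReal.ofReal (a x) * ENNReal.ofReal (b y))] at hsum
  simp_rw [ENNReal.tsum_mul_left, ENNReal.tsum_mul_right] at hsum
  rw [tsum_ofReal_measureReal_preimage hμ hZ, tsum_ofReal_measureReal_preimage hμ hY] at hsum
  have hsum' : shannonEntropy μ (fun ω => (Z ω, Y ω)) + μ Set.univ ≤
      shannonEntropy μ Z + shannonEntropy μ Y + μ Set.univ :=
    hsum.trans (by gcongr; exact mul_le_of_le_one_left' hμ)
  exact (ENNReal.add_le_add_iff_right (measure_ne_top μ _)).1 hsum'

/-- Entropy over a finite alphabet. -/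
theorem shannonEntropy_le_of_mem_finset [Countable S] [MeasurableSpace S]
    [MeasurableSingletonClass S] (hμ : μ Set.univ ≤ 1) {Z : Ω → S} (hZ : Measurable Z)
    {F : Finset S} (hF : ∀ᵐ ω ∂μ, Z ω ∈ F) :
    shannonEntropy μ Z ≤ μ Set.univ * ENNReal.ofReal (Real.log F.card) + 1 := by
  have := isFiniteMeasure_of_le_one hμ
  rcases F.eq_empty_or_nonempty with rfl | hne
  · have : μ = 0 := by
      have h : ∀ᵐ ω ∂μ, False := by simpa using hF
      exact ae_eq_bot.1 (eventually_false_iff_eq_bot.1 h)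
    simp [this, shannonEntropy]
  have hcard : (0 : ℝ) < F.card := by exact_mod_cast hne.card_pos
  have hlog : 0 ≤ Real.log F.card := Real.log_nonneg (by exact_mod_cast hne.card_pos)
  have h0 : ∀ s ∉ F, ENNReal.ofReal (Real.negMulLog (μ.real (Z ⁻¹' {s}))) = 0 := by
    intro s hs
    have : μ (Z ⁻¹' {s}) = 0 := by
      rw [measure_eq_zero_iff_ae_notMem]
      filter_upwards [hF] with ω hω hh
      exact hs (by simpa [← show Z ω = s from hh] using hω)
    simp [Measure.real, this]
  rw [shannonEntropy, tsum_eq_sum h0]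
  have hpt : ∀ s ∈ F, ENNReal.ofReal (Real.negMulLog (μ.real (Z ⁻¹' {s}))) ≤
      ENNReal.ofReal (μ.real (Z ⁻¹' {s})) * ENNReal.ofReal (Real.log F.card)
        + ENNReal.ofReal (1 / F.card) := by
    intro s _
    have hp : 0 ≤ μ.real (Z ⁻¹' {s}) := measureReal_nonneg
    -- Comparison with the uniform weights on `F`; these weights sum to one, which is the `+ 1` in
    -- the bound.
    have h := negMulLog_add_le (a := 1 / F.card) (b := 1) (c := μ.real (Z ⁻¹' {s}))
      (by positivity) zero_le_one hp (fun h => absurd h (by positivity))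
      (fun h => absurd h one_ne_zero)
    rw [← ENNReal.ofReal_mul hp, ← ENNReal.ofReal_add (mul_nonneg hp hlog) (by positivity)]
    refine ENNReal.ofReal_le_ofReal ?_
    simp only [one_div, Real.log_inv, neg_neg, Real.log_one, neg_zero, mul_zero, add_zero,
      mul_one] at h ⊢
    linarith
  refine (Finset.sum_le_sum hpt).trans ?_
  rw [Finset.sum_add_distrib, ← Finset.sum_mul]
  gcongr
  · rw [← tsum_ofReal_measureReal_preimage hμ hZ]
    exact ENNReal.sum_le_tsum _
  · rw [Finset.sum_const, nsmul_eq_mul, ← ENNReal.ofReal_natCast, ← ENNReal.ofReal_mul hcard.le]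
    simp [hcard.ne']

/-- Subadditivity of entropy for finite families. -/
theorem shannonEntropy_pi_le [Countable S] [MeasurableSpace S] [MeasurableSingletonClass S]
    [IsProbabilityMeasure μ] {n : ℕ} (Z : Fin n → Ω → S) (hZ : ∀ i, Measurable (Z i)) :
    shannonEntropy μ (fun ω => fun i => Z i ω) ≤ ∑ i, shannonEntropy μ (Z i) := by
  have hμ : μ Set.univ ≤ 1 := by simp
  induction n with
  | zero =>
    rw [Finset.univ_eq_empty, Finset.sum_empty]
    rw [nonpos_iff_eq_zero, shannonEntropy, ENNReal.tsum_eq_zero]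
    intro s
    have : (fun ω => fun i => Z i ω) ⁻¹' {s} = Set.univ :=
      Set.eq_univ_of_forall fun ω => Subsingleton.elim _ _
    simp [this]
  | succ n ih =>
    rw [Fin.sum_univ_castSucc]
    refine le_trans ?_ ((shannonEntropy_prodMk_le hμ
      (measurable_pi_lambda (fun ω => fun i : Fin n => Z i.castSucc ω) fun i => hZ _)
      (hZ (Fin.last n))).trans (add_le_add_left (ih _ fun i => hZ _) _))
    refine shannonEntropy_comp_le hμ ((measurable_pi_lambda _ fun i => hZ _).prodMk (hZ _))
      (measurable_pi_lambda _ hZ) fun ω ω' h => ?_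
    rw [Prod.mk.injEq] at h
    funext i
    refine Fin.lastCases h.2 (fun i => congrFun h.1 i) i

/-- Additivity of entropy for independent families. -/
theorem shannonEntropy_pi_of_iIndepFun [Countable S] [MeasurableSpace S]
    [MeasurableSingletonClass S] [IsProbabilityMeasure μ] {n : ℕ} (Z : Fin n → Ω → S)
    (hZ : ∀ i, Measurable (Z i)) (hind : iIndepFun Z μ) :
    shannonEntropy μ (fun ω => fun i => Z i ω) = ∑ i, shannonEntropy μ (Z i) := by
  -- A statement about products of marginals only, so independence enters just once at the end. The
  -- normalization is carried through the induction because the product rule for `Real.negMulLog`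
  -- weights each factor's entropy by the total mass of the other.
  have key : ∀ (n : ℕ) (Z : Fin n → Ω → S), (∀ i, Measurable (Z i)) →
      ∑' s : Fin n → S, ENNReal.ofReal (Real.negMulLog (∏ i, μ.real (Z i ⁻¹' {s i})))
        = ∑ i, shannonEntropy μ (Z i) ∧
      ∑' s : Fin n → S, ENNReal.ofReal (∏ i, μ.real (Z i ⁻¹' {s i})) = 1 := by
    intro n
    induction n with
    | zero => intro Z _; simp
    | succ n ih =>
      intro Z hZ
      obtain ⟨h1, h2⟩ := ih (fun i => Z i.succ) fun i => hZ _
      have hp0 : ∀ i s, 0 ≤ μ.real (Z i ⁻¹' {s}) := fun _ _ => measureReal_nonneg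
      have hp1 : ∀ i s, μ.real (Z i ⁻¹' {s}) ≤ 1 := fun _ _ =>
        measureReal_le_one_of_univ (by simp) _
      have hq0 : ∀ s : Fin n → S, 0 ≤ ∏ i, μ.real (Z i.succ ⁻¹' {s i}) :=
        fun s => Finset.prod_nonneg fun i _ => hp0 _ _
      have hq1 : ∀ s : Fin n → S, ∏ i, μ.real (Z i.succ ⁻¹' {s i}) ≤ 1 :=
        fun s => Finset.prod_le_one (fun i _ => hp0 _ _) fun i _ => hp1 _ _
      have h3 : ∑' s, ENNReal.ofReal (μ.real (Z 0 ⁻¹' {s})) = 1 := by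
        rw [tsum_ofReal_measureReal_preimage (by simp) (hZ 0), measure_univ]
      constructor
      · rw [← (Fin.consEquiv fun _ => S).tsum_eq, ENNReal.tsum_prod', Fin.sum_univ_succ]
        simp only [Fin.consEquiv_apply, Fin.prod_univ_succ, Fin.cons_zero, Fin.cons_succ]
        have : ∀ x (s : Fin n → S), ENNReal.ofReal (Real.negMulLog
            (μ.real (Z 0 ⁻¹' {x}) * ∏ i, μ.real (Z i.succ ⁻¹' {s i}))) =
            ENNReal.ofReal (∏ i, μ.real (Z i.succ ⁻¹' {s i})) *
              ENNReal.ofReal (Real.negMulLog (μ.real (Z 0 ⁻¹' {x}))) +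
            ENNReal.ofReal (μ.real (Z 0 ⁻¹' {x})) *
              ENNReal.ofReal (Real.negMulLog (∏ i, μ.real (Z i.succ ⁻¹' {s i}))) := by
          intro x s
          rw [Real.negMulLog_mul, ENNReal.ofReal_add, ENNReal.ofReal_mul (hq0 s),
            ENNReal.ofReal_mul (hp0 _ _)]
          · exact mul_nonneg (hq0 s) (Real.negMulLog_nonneg (hp0 _ _) (hp1 _ _))
          · exact mul_nonneg (hp0 _ _) (Real.negMulLog_nonneg (hq0 s) (hq1 s))
        simp_rw [this, ENNReal.tsum_add, ENNReal.tsum_mul_left, ENNReal.tsum_mul_right, h1, h2, h3,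
          one_mul]
        rfl
      · rw [← (Fin.consEquiv fun _ => S).tsum_eq, ENNReal.tsum_prod']
        simp only [Fin.consEquiv_apply, Fin.prod_univ_succ, Fin.cons_zero, Fin.cons_succ]
        simp_rw [ENNReal.ofReal_mul (hp0 _ _), ENNReal.tsum_mul_left, h2, mul_one, h3]
  rw [← (key n Z hZ).1, shannonEntropy]
  refine tsum_congr fun s => ?_
  have : (fun ω => fun i => Z i ω) ⁻¹' {s} = ⋂ i ∈ Finset.univ, Z i ⁻¹' {s i} := by
    ext ω
    simp [funext_iff]
  rw [this, Measure.real, hind.measure_inter_preimage_eq_mul Finset.univ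
    (fun i _ => measurableSet_singleton _), ENNReal.toReal_prod]
  rfl

end Entropy

/-! ### Dependence of the quantized entropy on the resolution. -/

section Quantization

variable {Ω : Type*} [MeasurableSpace Ω] {μ : Measure Ω}

theorem measurable_floor_mul {Y : Ω → ℝ} (hY : Measurable Y) (k : ℕ) :
    Measurable fun ω => ⌊(k : ℝ) * Y ω⌋ :=
  (hY.const_mul _).floor

theorem injective_intCast_div {k : ℕ} (hk : 1 ≤ k) :
    Function.Injective fun j : ℤ => (j : ℝ) / (k : ℝ) := by
  have hk' : (k : ℝ) ≠ 0 := by positivity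
  intro a b h
  simpa [div_left_inj' hk'] using h

theorem quantEntropy_eq_floor (Y : Ω → ℝ) {k : ℕ} (hk : 1 ≤ k) :
    quantEntropy μ Y k = shannonEntropy μ fun ω => ⌊(k : ℝ) * Y ω⌋ :=
  shannonEntropy_comp_injective (injective_intCast_div hk) fun ω => ⌊(k : ℝ) * Y ω⌋

theorem blockEntropy_eq_floor (X : ℤ → Ω → ℝ) (n : ℕ) {k : ℕ} (hk : 1 ≤ k) :
    blockEntropy μ X n k =
      shannonEntropy μ fun ω => fun i : Fin n => ⌊(k : ℝ) * X ((i : ℤ) + 1) ω⌋ :=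
  shannonEntropy_comp_injective
    (f := fun (v : Fin n → ℤ) (i : Fin n) => (v i : ℝ) / (k : ℝ))
    (fun _ _ h => funext fun i => injective_intCast_div hk (congrFun h i))
    fun ω => fun i : Fin n => ⌊(k : ℝ) * X ((i : ℤ) + 1) ω⌋

/-- Refining the quantization by a factor `k` costs at most `log k`. -/
theorem quantEntropy_le (hμ : μ Set.univ ≤ 1) {Y : Ω → ℝ} (hY : Measurable Y) {k : ℕ}
    (hk : 1 ≤ k) :
    quantEntropy μ Y k ≤
      quantEntropy μ Y 1 + (μ Set.univ * ENNReal.ofReal (Real.log k) + 1) := by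
  rw [quantEntropy_eq_floor Y hk, quantEntropy_eq_floor Y le_rfl]
  have hk' : (k : ℝ) ≠ 0 := by positivity
  have hk0 : (0 : ℤ) < k := by exact_mod_cast hk
  have h1 := measurable_floor_mul hY 1
  have hkm := measurable_floor_mul hY k
  -- The fine cell index is recovered from the unit cell, its quotient by `k`, and its residue,
  -- which takes only `k` values.
  have hU : Measurable fun ω => ⌊(k : ℝ) * Y ω⌋ % (k : ℤ) :=
    (measurable_of_countable fun j : ℤ => j % (k : ℤ)).comp hkm
  have hfin := shannonEntropy_le_of_mem_finset hμ hU (F := Finset.Ico (0 : ℤ) k)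
    (Eventually.of_forall fun ω => by
      rw [Finset.mem_Ico]
      exact ⟨Int.emod_nonneg _ hk0.ne', Int.emod_lt_of_pos _ hk0⟩)
  rw [Int.card_Ico, sub_zero, Int.toNat_natCast] at hfin
  refine le_trans ?_ ((shannonEntropy_prodMk_le hμ h1 hU).trans (by gcongr))
  refine shannonEntropy_comp_le hμ (h1.prodMk hU) hkm fun ω ω' h => ?_
  have key : ∀ x : ℝ, ⌊((1 : ℕ) : ℝ) * x⌋ = ⌊(k : ℝ) * x⌋ / (k : ℤ) := fun x => by
    rw [← Int.floor_div_natCast]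
    congr 1
    field_simp
    simp
  rw [Prod.mk.injEq, key, key] at h
  rw [← Int.mul_ediv_add_emod ⌊(k : ℝ) * Y ω⌋ k, ← Int.mul_ediv_add_emod ⌊(k : ℝ) * Y ω'⌋ k,
    h.1, h.2]

theorem quantEntropy_map {Y : Ω → ℝ} (hY : Measurable Y) (k : ℕ) :
    quantEntropy (μ.map Y) id k = quantEntropy μ Y k := by
  refine shannonEntropy_congr fun s => ?_
  rw [Measure.map_apply hY]
  · rfl
  · have : Measurable (quantize k) := by unfold quantize; fun_prop
    exact this (measurableSet_singleton s)

end Quantization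

/-! ### Entropy of blocks generated by an integer recursion. -/

section Recursion

variable {Ω : Type*} [MeasurableSpace Ω] {μ : Measure Ω} [IsProbabilityMeasure μ]

/-- If `A` obeys a recursion driven by `B` and `U`, the entropy of a block of `A` is controlled by
the entropies of the initial conditions and of the blocks of `B` and `U`. -/
theorem shannonEntropy_block_le_of_recursion {p q : ℕ} {A B U : ℤ → Ω → ℤ}
    (hA : ∀ t, Measurable (A t)) (hB : ∀ t, Measurable (B t)) (hU : ∀ t, Measurable (U t))
    (g : (Fin p → ℤ) → (Fin q → ℤ) → ℤ → ℤ)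
    (hrec : ∀ t ω, A t ω = U t ω + g (fun i => A (t - ((i : ℤ) + 1)) ω)
      (fun i => B (t - ((i : ℤ) + 1)) ω) (B t ω)) (n : ℕ) :
    shannonEntropy μ (fun ω => fun i : Fin n => A ((i : ℤ) + 1) ω) ≤
      (∑ i : Fin p, shannonEntropy μ (A (-(i : ℤ))) + ∑ i : Fin q, shannonEntropy μ (B (-(i : ℤ))))
      + (shannonEntropy μ (fun ω => fun i : Fin n => B ((i : ℤ) + 1) ω)
        + ∑ i : Fin n, shannonEntropy μ (U ((i : ℤ) + 1))) := by
  have hμ : μ Set.univ ≤ 1 := by simp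
  have mA : Measurable fun ω => fun i : Fin p => A (-(i : ℤ)) ω :=
    measurable_pi_lambda _ fun i => hA _
  have mB : Measurable fun ω => fun i : Fin q => B (-(i : ℤ)) ω :=
    measurable_pi_lambda _ fun i => hB _
  have mB' : Measurable fun ω => fun i : Fin n => B ((i : ℤ) + 1) ω :=
    measurable_pi_lambda _ fun i => hB _
  have mU : Measurable fun ω => fun i : Fin n => U ((i : ℤ) + 1) ω :=
    measurable_pi_lambda _ fun i => hU _
  refine le_trans (shannonEntropy_comp_le hμ ((mA.prodMk mB).prodMk (mB'.prodMk mU))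
    (measurable_pi_lambda _ fun i => hA _) fun ω ω' h => ?_)
    ((shannonEntropy_prodMk_le hμ (mA.prodMk mB) (mB'.prodMk mU)).trans (add_le_add
      ((shannonEntropy_prodMk_le hμ mA mB).trans (add_le_add
        (shannonEntropy_pi_le _ fun i => hA _) (shannonEntropy_pi_le _ fun i => hB _)))
      ((shannonEntropy_prodMk_le hμ mB' mU).trans (add_le_add le_rfl
        (shannonEntropy_pi_le _ fun i => hU _)))))
  simp only [Prod.mk.injEq] at h
  obtain ⟨⟨h1, h2⟩, h3, h4⟩ := h
  have hBeq : ∀ t : ℤ, -(q : ℤ) < t → t ≤ n → B t ω = B t ω' := by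
    intro t ht1 ht2
    rcases le_or_gt t 0 with h0 | h0
    · have := congrFun h2 ⟨(-t).toNat, by omega⟩
      simpa only [show -(((-t).toNat : ℕ) : ℤ) = t by omega] using this
    · have := congrFun h3 ⟨(t - 1).toNat, by omega⟩
      simpa only [show (((t - 1).toNat : ℕ) : ℤ) + 1 = t by omega] using this
  -- The range reaches back to `-p + 1`, the oldest initial condition, so at time `m + 1` all `p`
  -- lagged values are covered by the induction hypothesis.
  have key : ∀ m : ℕ, m ≤ n → ∀ t : ℤ, -(p : ℤ) < t → t ≤ m → A t ω = A t ω' := by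
    intro m
    induction m with
    | zero =>
      intro _ t ht1 ht2
      have := congrFun h1 ⟨(-t).toNat, by omega⟩
      simpa only [show -(((-t).toNat : ℕ) : ℤ) = t by omega] using this
    | succ m ih =>
      intro hm t ht1 ht2
      rcases le_or_gt t m with h0 | h0
      · exact ih (by omega) t ht1 h0
      · have hU' : U t ω = U t ω' := by
          have := congrFun h4 ⟨(t - 1).toNat, by omega⟩
          simpa only [show (((t - 1).toNat : ℕ) : ℤ) + 1 = t by omega] using this
        rw [hrec t ω, hrec t ω', hU', hBeq t (by omega) (by omega)]
        congr 2
        · funext i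
          exact ih (by omega) _ (by omega) (by omega)
        · funext i
          exact hBeq _ (by omega) (by omega)
  funext i
  exact key n le_rfl _ (by omega) (by omega)

end Recursion

/-! ### Comparison of the ARMA process with its noise. -/

section ARMA

variable {Ω : Type*} [MeasurableSpace Ω] {μ : Measure Ω} [IsProbabilityMeasure μ]

theorem abs_sum_mul_sub_sum_mul_floor_le {n : ℕ} (c x : Fin n → ℝ) :
    |∑ i, c i * x i - ∑ i, c i * (⌊x i⌋ : ℝ)| ≤ ∑ i, |c i| := by
  rw [← Finset.sum_sub_distrib]
  refine (Finset.abs_sum_le_sum_abs _ _).trans (Finset.sum_le_sum fun i _ => ?_)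
  rw [← mul_sub, abs_mul]
  refine mul_le_of_le_one_right (abs_nonneg _) ?_
  rw [Int.self_sub_floor, abs_of_nonneg (Int.fract_nonneg _)]
  exact (Int.fract_lt_one _).le

/-- The floor of an affine recursion agrees with the recursion of the floors up to a bounded
error. -/
theorem floor_sub_floor_mem_Icc {m n : ℕ} (c x : Fin m → ℝ) (d y : Fin n → ℝ) (a b : ℝ)
    (h : b = ∑ i, c i * x i + a + ∑ i, d i * y i) {N : ℤ}
    (hN : ∑ i, |c i| + ∑ i, |d i| + 3 ≤ N) :
    ⌊b⌋ - ⌊∑ i, c i * (⌊x i⌋ : ℝ) + ⌊a⌋ + ∑ i, d i * (⌊y i⌋ : ℝ)⌋ ∈ Finset.Icc (-N) N := by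
  have h1 := abs_le.1 (abs_sum_mul_sub_sum_mul_floor_le c x)
  have h2 := abs_le.1 (abs_sum_mul_sub_sum_mul_floor_le d y)
  set z := ∑ i, c i * (⌊x i⌋ : ℝ) + ⌊a⌋ + ∑ i, d i * (⌊y i⌋ : ℝ) with hz
  have := Int.floor_le a
  have := Int.lt_floor_add_one a
  have := Int.floor_le b
  have := Int.lt_floor_add_one b
  have := Int.floor_le z
  have := Int.lt_floor_add_one z
  rw [Finset.mem_Icc]
  constructor
  · have : ((-N : ℤ) : ℝ) ≤ ((⌊b⌋ - ⌊z⌋ : ℤ) : ℝ) := by push_cast; linarith [h1.1, h2.1]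
    exact_mod_cast this
  · have : ((⌊b⌋ - ⌊z⌋ : ℤ) : ℝ) ≤ (N : ℝ) := by push_cast; linarith [h1.2, h2.2]
    exact_mod_cast this

theorem measurable_sub_comp_past {p q : ℕ} {A B : ℤ → Ω → ℤ} (hA : ∀ t, Measurable (A t))
    (hB : ∀ t, Measurable (B t)) (g : (Fin p → ℤ) → (Fin q → ℤ) → ℤ → ℤ) (t : ℤ) :
    Measurable fun ω => A t ω - g (fun i => A (t - ((i : ℤ) + 1)) ω)
      (fun i => B (t - ((i : ℤ) + 1)) ω) (B t ω) := by
  have hg : Measurable fun x : (Fin p → ℤ) × (Fin q → ℤ) × ℤ => g x.1 x.2.1 x.2.2 :=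
    measurable_of_countable _
  exact (hA t).sub (hg.comp ((measurable_pi_lambda _ fun i => hA _).prodMk
    ((measurable_pi_lambda _ fun i => hB _).prodMk (hB t))))

/-- Blocks of the floors of a process obeying an affine recursion driven by `b`. -/
theorem shannonEntropy_floor_block_le {p q : ℕ} (c : Fin p → ℝ) (d : Fin q → ℝ)
    {a b : ℤ → Ω → ℝ} (ha : ∀ t, Measurable (a t)) (hb : ∀ t, Measurable (b t))
    (hrec : ∀ t, ∀ᵐ ω ∂μ, a t ω = ∑ i : Fin p, c i * a (t - ((i : ℤ) + 1)) ω + b t ω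
      + ∑ i : Fin q, d i * b (t - ((i : ℤ) + 1)) ω)
    {N : ℤ} (hN : ∑ i, |c i| + ∑ i, |d i| + 3 ≤ N) (n : ℕ) :
    shannonEntropy μ (fun ω => fun i : Fin n => ⌊a ((i : ℤ) + 1) ω⌋) ≤
      (∑ i : Fin p, shannonEntropy μ (fun ω => ⌊a (-(i : ℤ)) ω⌋)
        + ∑ i : Fin q, shannonEntropy μ (fun ω => ⌊b (-(i : ℤ)) ω⌋))
      + (shannonEntropy μ (fun ω => fun i : Fin n => ⌊b ((i : ℤ) + 1) ω⌋)
        + n * (ENNReal.ofReal (Real.log (Finset.Icc (-N) N).card) + 1)) := by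
  have hA : ∀ t, Measurable fun ω => ⌊a t ω⌋ := fun t => (ha t).floor
  have hB : ∀ t, Measurable fun ω => ⌊b t ω⌋ := fun t => (hb t).floor
  let g : (Fin p → ℤ) → (Fin q → ℤ) → ℤ → ℤ := fun x y z =>
    ⌊∑ i, c i * (x i : ℝ) + z + ∑ i, d i * (y i : ℝ)⌋
  -- Taking the rounding error as a driving term makes the integer recursion exact everywhere; the
  -- almost sure ARMA equation is needed only to confine `U` to `Finset.Icc (-N) N`.
  let U : ℤ → Ω → ℤ := fun t ω => ⌊a t ω⌋ - g (fun i => ⌊a (t - ((i : ℤ) + 1)) ω⌋)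
    (fun i => ⌊b (t - ((i : ℤ) + 1)) ω⌋) ⌊b t ω⌋
  have hU : ∀ t, Measurable (U t) := measurable_sub_comp_past hA hB g
  have hUF : ∀ t, shannonEntropy μ (U t) ≤
      ENNReal.ofReal (Real.log (Finset.Icc (-N) N).card) + 1 := fun t => by
    have h := shannonEntropy_le_of_mem_finset (by simp) (hU t) ((hrec t).mono fun ω hω =>
        floor_sub_floor_mem_Icc c _ d _ _ _ hω hN)
    rwa [measure_univ, one_mul] at h
  refine (shannonEntropy_block_le_of_recursion hA hB hU g
    (fun t ω => (sub_add_cancel _ _).symm) n).trans ?_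
  gcongr
  refine (Finset.sum_le_sum fun i _ => hUF _).trans_eq ?_
  rw [Finset.sum_const, Finset.card_univ, Fintype.card_fin, nsmul_eq_mul]

/-- The quantized noise block has entropy `n H([ξ₀]ₖ)`. -/
theorem shannonEntropy_floor_noise_block {ξ : ℤ → Ω → ℝ} (hm : ∀ t, Measurable (ξ t))
    (hind : iIndepFun ξ μ) (hid : ∀ t, IdentDistrib (ξ t) (ξ 0) μ μ) {k : ℕ} (hk : 1 ≤ k)
    (n : ℕ) :
    shannonEntropy μ (fun ω => fun i : Fin n => ⌊(k : ℝ) * ξ ((i : ℤ) + 1) ω⌋)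
      = n * quantEntropy μ (ξ 0) k := by
  have hf : Measurable fun x : ℝ => ⌊(k : ℝ) * x⌋ := measurable_floor_mul measurable_id k
  have hinj : Function.Injective fun i : Fin n => (i : ℤ) + 1 := fun a b h =>
    Fin.ext (by simpa using h)
  have hind' : iIndepFun (fun (i : Fin n) ω => ⌊(k : ℝ) * ξ ((i : ℤ) + 1) ω⌋) μ :=
    (hind.precomp hinj).comp (fun _ x => ⌊(k : ℝ) * x⌋) fun _ => hf
  rw [shannonEntropy_pi_of_iIndepFun _ (fun i => measurable_floor_mul (hm _) k) hind',
    quantEntropy_eq_floor _ hk]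
  have h : ∀ i : Fin n, shannonEntropy μ (fun ω => ⌊(k : ℝ) * ξ ((i : ℤ) + 1) ω⌋)
      = shannonEntropy μ fun ω => ⌊(k : ℝ) * ξ 0 ω⌋ :=
    fun i => IdentDistrib.shannonEntropy_eq ((hid _).comp hf)
  simp [h]

/-- Uniform two-sided comparison of the entropy of an ARMA process with that of its noise. -/
theorem IsARMA.blockEntropy_bounds {p q : ℕ} {φ : Fin p → ℝ} {θ : Fin q → ℝ}
    {ξ X : ℤ → Ω → ℝ} (hX : IsARMA μ φ θ ξ X) (hfin : ∀ t : ℤ, quantEntropy μ (X t) 1 < ∞) :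
    ∃ C D : ℝ≥0, ∀ k : ℕ, 1 ≤ k → ∀ n : ℕ,
      blockEntropy μ X n k ≤ n * (quantEntropy μ (ξ 0) k + C)
        + (D + p * ENNReal.ofReal (Real.log k) + q * quantEntropy μ (ξ 0) k) ∧
      n * quantEntropy μ (ξ 0) k ≤ blockEntropy μ X n k + n * C
        + (D + p * ENNReal.ofReal (Real.log k) + q * quantEntropy μ (ξ 0) k) := by
  -- One `N` serves every `k` and both directions, since scaling by `k` leaves the coefficients
  -- unchanged and solving for the noise only swaps the two families and flips signs.
  obtain ⟨N, hN⟩ : ∃ N : ℤ, ∑ i, |φ i| + ∑ i, |θ i| + 3 ≤ N := ⟨_, Int.le_ceil _⟩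
  have hC : ENNReal.ofReal (Real.log (Finset.Icc (-N) N).card) + 1 ≠ ∞ :=
    ENNReal.add_ne_top.2 ⟨ENNReal.ofReal_ne_top, ENNReal.one_ne_top⟩
  have hD : ∑ i : Fin p, (quantEntropy μ (X (-(i : ℤ))) 1 + 1) ≠ ∞ :=
    ENNReal.sum_ne_top.2 fun i _ => ENNReal.add_ne_top.2 ⟨(hfin _).ne, ENNReal.one_ne_top⟩
  refine ⟨(ENNReal.ofReal (Real.log (Finset.Icc (-N) N).card) + 1).toNNReal,
    (∑ i : Fin p, (quantEntropy μ (X (-(i : ℤ))) 1 + 1)).toNNReal, fun k hk n => ?_⟩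
  rw [ENNReal.coe_toNNReal hC, ENNReal.coe_toNNReal hD]
  generalize hCeq : ENNReal.ofReal (Real.log (Finset.Icc (-N) N).card) + 1 = C at *
  have hA : ∀ t, Measurable fun ω => (k : ℝ) * X t ω :=
    fun t => (hX.measurable_process t).const_mul _
  have hB : ∀ t, Measurable fun ω => (k : ℝ) * ξ t ω :=
    fun t => (hX.measurable_noise t).const_mul _
  have hApast : ∑ i : Fin p, shannonEntropy μ (fun ω => ⌊(k : ℝ) * X (-(i : ℤ)) ω⌋)
      ≤ ∑ i : Fin p, (quantEntropy μ (X (-(i : ℤ))) 1 + 1) + p * ENNReal.ofReal (Real.log k) := by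
    have h : ∀ i : Fin p, shannonEntropy μ (fun ω => ⌊(k : ℝ) * X (-(i : ℤ)) ω⌋) ≤
        (quantEntropy μ (X (-(i : ℤ))) 1 + 1) + ENNReal.ofReal (Real.log k) := fun i => by
      have h := quantEntropy_le (μ := μ) prob_le_one (hX.measurable_process (-(i : ℤ))) hk
      rw [quantEntropy_eq_floor _ hk, measure_univ, one_mul] at h
      exact h.trans_eq (by ring)
    refine (Finset.sum_le_sum fun i _ => h i).trans_eq ?_
    rw [Finset.sum_add_distrib, Finset.sum_const, Finset.card_univ, Fintype.card_fin,
      nsmul_eq_mul]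
  generalize ∑ i : Fin p, (quantEntropy μ (X (-(i : ℤ))) 1 + 1) = D at *
  have hBpast : ∑ i : Fin q, shannonEntropy μ (fun ω => ⌊(k : ℝ) * ξ (-(i : ℤ)) ω⌋)
      = q * quantEntropy μ (ξ 0) k := by
    have hf : Measurable fun x : ℝ => ⌊(k : ℝ) * x⌋ := measurable_floor_mul measurable_id k
    have h : ∀ i : Fin q, shannonEntropy μ (fun ω => ⌊(k : ℝ) * ξ (-(i : ℤ)) ω⌋)
        = shannonEntropy μ fun ω => ⌊(k : ℝ) * ξ 0 ω⌋ :=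
      fun i => IdentDistrib.shannonEntropy_eq ((hX.identDistrib_noise _).comp hf)
    rw [quantEntropy_eq_floor _ hk]
    simp [h]
  have hrecA : ∀ t, ∀ᵐ ω ∂μ, (k : ℝ) * X t ω =
      ∑ i : Fin p, φ i * ((k : ℝ) * X (t - ((i : ℤ) + 1)) ω) + (k : ℝ) * ξ t ω
        + ∑ i : Fin q, θ i * ((k : ℝ) * ξ (t - ((i : ℤ) + 1)) ω) := fun t => by
    filter_upwards [hX.recursion t] with ω hω
    rw [hω, mul_add, mul_add, Finset.mul_sum, Finset.mul_sum]
    simp only [mul_left_comm]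
  -- The noise as a process driven by `X`: its coefficient in the equation is one, so it can be
  -- isolated.
  have hrecB : ∀ t, ∀ᵐ ω ∂μ, (k : ℝ) * ξ t ω =
      ∑ i : Fin q, -θ i * ((k : ℝ) * ξ (t - ((i : ℤ) + 1)) ω) + (k : ℝ) * X t ω
        + ∑ i : Fin p, -φ i * ((k : ℝ) * X (t - ((i : ℤ) + 1)) ω) := fun t => by
    filter_upwards [hrecA t] with ω hω
    rw [hω]
    simp only [neg_mul, Finset.sum_neg_distrib]
    ring
  have hBblock := shannonEntropy_floor_noise_block hX.measurable_noise hX.indep_noise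
    hX.identDistrib_noise hk n
  have h1 := shannonEntropy_floor_block_le φ θ hA hB hrecA hN n
  have h2 := shannonEntropy_floor_block_le (fun i => -θ i) (fun i => -φ i) hB hA hrecB
    (N := N) (by simp only [abs_neg]; linarith) n
  rw [hCeq, hBblock, hBpast] at h1 h2
  rw [blockEntropy_eq_floor X n hk]
  constructor
  · refine h1.trans ((add_le_add_left (add_le_add_left hApast _) _).trans_eq ?_)
    ring
  · refine h2.trans ((add_le_add_left (add_le_add_right hApast _) _).trans_eq ?_)
    ring

end ARMA

/-! ### Existence of the entropy rate under stationarity. -/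

section Stationary

variable {Ω : Type*} [MeasurableSpace Ω] {μ : Measure Ω} [IsProbabilityMeasure μ]

theorem blockEntropy_lt_top {X : ℤ → Ω → ℝ} (hm : ∀ t, Measurable (X t))
    (hfin : ∀ t : ℤ, quantEntropy μ (X t) 1 < ∞) {k : ℕ} (hk : 1 ≤ k) (n : ℕ) :
    blockEntropy μ X n k < ∞ := by
  rw [blockEntropy_eq_floor X n hk]
  refine (shannonEntropy_pi_le (fun (i : Fin n) ω => ⌊(k : ℝ) * X ((i : ℤ) + 1) ω⌋)
    fun i => measurable_floor_mul (hm _) k).trans_lt (ENNReal.sum_lt_top.2 fun i _ => ?_)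
  rw [← quantEntropy_eq_floor _ hk]
  refine (quantEntropy_le (by simp) (hm _) hk).trans_lt ?_
  simp [hfin]

/-- Cutting the block after `m` entries leaves a second piece that is the block of length `n`
shifted by `m`, hence of the same law. This is the input to Fekete's lemma. -/
theorem IsStrictlyStationary.blockEntropy_add_le {X : ℤ → Ω → ℝ}
    (hs : IsStrictlyStationary μ X) (hm : ∀ t, Measurable (X t)) {k : ℕ} (hk : 1 ≤ k)
    (m n : ℕ) :
    blockEntropy μ X (m + n) k ≤ blockEntropy μ X m k + blockEntropy μ X n k := by
  rw [blockEntropy_eq_floor X m hk, blockEntropy_eq_floor X n hk, blockEntropy_eq_floor X _ hk]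
  have hshift : shannonEntropy μ (fun ω => fun i : Fin n => ⌊(k : ℝ) * X ((i : ℤ) + 1) ω⌋) =
      shannonEntropy μ (fun ω => fun i : Fin n => ⌊(k : ℝ) * X ((i : ℤ) + 1 + m) ω⌋) := by
    have hf : Measurable fun x : ℤ → ℝ => fun i : Fin n => ⌊(k : ℝ) * x ((i : ℤ) + 1)⌋ :=
      measurable_pi_lambda _ fun i =>
        measurable_floor_mul (Y := fun x : ℤ → ℝ => x ((i : ℤ) + 1)) (measurable_pi_apply _) k
    exact (IdentDistrib.shannonEntropy_eq ((hs m).comp hf)).symm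
  rw [hshift]
  have h1 : Measurable fun ω => fun i : Fin m => ⌊(k : ℝ) * X ((i : ℤ) + 1) ω⌋ :=
    measurable_pi_lambda _ fun i => measurable_floor_mul (hm _) k
  have h2 : Measurable fun ω => fun i : Fin n => ⌊(k : ℝ) * X ((i : ℤ) + 1 + m) ω⌋ :=
    measurable_pi_lambda _ fun i => measurable_floor_mul (hm _) k
  refine le_trans (shannonEntropy_comp_le (by simp) (h1.prodMk h2)
    (measurable_pi_lambda _ fun i => measurable_floor_mul (hm _) k) fun ω ω' h => ?_)
    (shannonEntropy_prodMk_le (by simp) h1 h2)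
  rw [Prod.mk.injEq] at h
  funext i
  refine Fin.addCases (fun i => ?_) (fun i => ?_) i
  · simpa using congrFun h.1 i
  · have := congrFun h.2 i
    rw [Fin.val_natAdd, Nat.cast_add, show (m : ℤ) + (i : ℕ) + 1 = (i : ℕ) + 1 + m by ring]
    exact this

/-- The entropy rate of a quantized stationary process exists. -/
theorem IsStrictlyStationary.exists_tendsto_blockEntropy_div {X : ℤ → Ω → ℝ}
    (hs : IsStrictlyStationary μ X) (hm : ∀ t, Measurable (X t))
    (hfin : ∀ t : ℤ, quantEntropy μ (X t) 1 < ∞) {k : ℕ} (hk : 1 ≤ k) :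
    ∃ h : ℝ≥0, Tendsto (fun n : ℕ => blockEntropy μ X n k / (n : ℝ≥0∞)) atTop
      (𝓝 (h : ℝ≥0∞)) := by
  have hlt := blockEntropy_lt_top hm hfin hk
  have hsub : Subadditive fun n => (blockEntropy μ X n k).toReal := fun m n => by
    rw [← ENNReal.toReal_add (hlt m).ne (hlt n).ne]
    exact ENNReal.toReal_mono (ENNReal.add_ne_top.2 ⟨(hlt m).ne, (hlt n).ne⟩)
      (hs.blockEntropy_add_le hm hk m n)
  have hlim := hsub.tendsto_lim ⟨0, by rintro _ ⟨n, rfl⟩; positivity⟩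
  refine ⟨hsub.lim.toNNReal, ?_⟩
  refine (ENNReal.tendsto_ofReal hlim).congr' ?_
  filter_upwards [eventually_gt_atTop 0] with n hn
  rw [ENNReal.ofReal_div_of_pos (by exact_mod_cast hn), ENNReal.ofReal_toReal (hlt n).ne,
    ENNReal.ofReal_natCast]

end Stationary

/-! ### Entropy under splitting of the measure. -/

section Mixture

variable {Ω S : Type*} [MeasurableSpace Ω]

/-- `Real.negMulLog` is not monotone, but `log (1 + b / a) ≤ b / a` bounds the loss by `b`, and the
remaining term `-b log (a + b)` has the right sign because `a + b ≤ 1`. -/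
theorem negMulLog_le_negMulLog_add_add {a b : ℝ} (ha : 0 ≤ a) (hb : 0 ≤ b) (hab : a + b ≤ 1) :
    Real.negMulLog a ≤ Real.negMulLog (a + b) + b := by
  rcases ha.eq_or_lt with rfl | ha
  · have := Real.negMulLog_nonneg (x := 0 + b) (by linarith) hab
    simpa using add_nonneg this hb
  have h := Real.log_le_sub_one_of_pos (show 0 < (a + b) / a by positivity)
  rw [Real.log_div (by positivity) ha.ne'] at h
  have h2 := mul_le_mul_of_nonneg_left h ha.le
  have h3 : a * ((a + b) / a - 1) = b := by field_simp; ring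
  have h4 : b * Real.log (a + b) ≤ 0 :=
    mul_nonpos_of_nonneg_of_nonpos hb (Real.log_nonpos (by positivity) hab)
  rw [h3] at h2
  unfold Real.negMulLog
  linarith

theorem negMulLog_add_le_add {a b : ℝ} (ha : 0 ≤ a) (hb : 0 ≤ b) :
    Real.negMulLog (a + b) ≤ Real.negMulLog a + Real.negMulLog b := by
  rcases ha.eq_or_lt with rfl | ha
  · simp
  rcases hb.eq_or_lt with rfl | hb
  · simp
  have h1 := mul_le_mul_of_nonneg_left (Real.log_le_log ha (by linarith : a ≤ a + b)) ha.le
  have h2 := mul_le_mul_of_nonneg_left (Real.log_le_log hb (by linarith : b ≤ a + b)) hb.le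
  unfold Real.negMulLog
  linarith

theorem shannonEntropy_add_measure_le {μ₁ μ₂ : Measure Ω} [IsFiniteMeasure μ₁]
    [IsFiniteMeasure μ₂] (h1 : μ₁ Set.univ ≤ 1) (h2 : μ₂ Set.univ ≤ 1) (Z : Ω → S) :
    shannonEntropy (μ₁ + μ₂) Z ≤ shannonEntropy μ₁ Z + shannonEntropy μ₂ Z := by
  unfold shannonEntropy
  rw [← ENNReal.tsum_add]
  refine ENNReal.tsum_le_tsum fun s => ?_
  rw [← ENNReal.ofReal_add
    (Real.negMulLog_nonneg measureReal_nonneg (measureReal_le_one_of_univ h1 _))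
    (Real.negMulLog_nonneg measureReal_nonneg (measureReal_le_one_of_univ h2 _)),
    measureReal_add_apply]
  exact ENNReal.ofReal_le_ofReal (negMulLog_add_le_add measureReal_nonneg measureReal_nonneg)

/-- Summing the cellwise loss gives the total mass of the discarded part, which is at most one
whatever the partition; the cost is therefore uniform in `k`. -/
theorem shannonEntropy_le_add_measure [Countable S] [MeasurableSpace S]
    [MeasurableSingletonClass S] {μ₁ μ₂ : Measure Ω} [IsFiniteMeasure μ₁]
    [IsFiniteMeasure μ₂] (h : (μ₁ + μ₂) Set.univ ≤ 1) {Z : Ω → S} (hZ : Measurable Z) :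
    shannonEntropy μ₁ Z ≤ shannonEntropy (μ₁ + μ₂) Z + 1 := by
  have h2 : μ₂ Set.univ ≤ 1 := (Measure.le_add_left le_rfl Set.univ).trans h
  refine le_trans ?_ (add_le_add le_rfl h2)
  rw [← tsum_ofReal_measureReal_preimage h2 hZ]
  unfold shannonEntropy
  rw [← ENNReal.tsum_add]
  refine ENNReal.tsum_le_tsum fun s => ?_
  have hs := measureReal_le_one_of_univ h (Z ⁻¹' {s})
  rw [← ENNReal.ofReal_add
    (Real.negMulLog_nonneg measureReal_nonneg hs) measureReal_nonneg]
  rw [measureReal_add_apply] at hs ⊢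
  exact ENNReal.ofReal_le_ofReal
    (negMulLog_le_negMulLog_add_add measureReal_nonneg measureReal_nonneg hs)

/-- Every charged cell has information density at least `-log c`. With `c` of order `1 / k` this
yields growth like the total mass times `log k`. -/
theorem mul_neg_log_le_shannonEntropy [Countable S] [MeasurableSpace S]
    [MeasurableSingletonClass S] {μ : Measure Ω} (h : μ Set.univ ≤ 1) {Z : Ω → S}
    (hZ : Measurable Z) {c : ℝ} (hc : ∀ s, μ.real (Z ⁻¹' {s}) ≤ c) :
    μ Set.univ * ENNReal.ofReal (-Real.log c) ≤ shannonEntropy μ Z := by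
  rw [← tsum_ofReal_measureReal_preimage h hZ, ← ENNReal.tsum_mul_right]
  refine ENNReal.tsum_le_tsum fun s => ?_
  rw [ofReal_negMulLog measureReal_nonneg]
  rcases (measureReal_nonneg (μ := μ) (s := Z ⁻¹' {s})).eq_or_lt with h0 | h0
  · simp [← h0]
  · gcongr
    exact hc s

theorem exists_measure_le_of_antitone {μ : Measure Ω} [IsFiniteMeasure μ] {s : ℕ → Set Ω}
    (hs : ∀ n, MeasurableSet (s n)) (hm : Antitone s) (h0 : μ (⋂ n, s n) = 0) {ε : ℝ≥0}
    (hε : 0 < ε) : ∃ n, μ (s n) ≤ ε := by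
  have h := tendsto_measure_iInter_atTop (μ := μ) (fun n => (hs n).nullMeasurableSet) hm
    ⟨0, measure_ne_top _ _⟩
  rw [h0] at h
  exact ((h.eventually_lt_const (by exact_mod_cast hε)).exists).imp fun n hn => hn.le

end Mixture

/-! ### Rényi's theorem for discrete-continuous laws. -/

section DiscreteContinuous

/-- A discrete law has nearly all of its mass on a finite set. -/
theorem exists_finset_compl_le {ν : Measure ℝ} [IsProbabilityMeasure ν] {S : Set ℝ}
    (hS : S.Countable) (hν : ν Sᶜ = 0) {ε : ℝ≥0} (hε : 0 < ε) :
    ∃ F : Finset ℝ, ν (F : Set ℝ)ᶜ ≤ ε := by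
  have hne : S.Nonempty := by
    by_contra h
    simp [Set.not_nonempty_iff_eq_empty.1 h] at hν
  obtain ⟨f, rfl⟩ := hS.exists_eq_range hne
  obtain ⟨n, hn⟩ := exists_measure_le_of_antitone (μ := ν)
    (s := fun n => (((Finset.range n).image f : Finset ℝ) : Set ℝ)ᶜ)
    (fun n => (Finset.measurableSet _).compl)
    (fun m n hmn => Set.compl_subset_compl.2 (by
      exact_mod_cast Finset.image_subset_image (Finset.range_mono hmn)))
    (measure_mono_null (fun x hx => by
      rintro ⟨n, rfl⟩
      refine Set.mem_iInter.1 hx (n + 1) ?_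
      simp only [Finset.coe_image, Finset.coe_range]
      exact ⟨n, by simp, rfl⟩) hν) hε
  exact ⟨_, hn⟩

/-- An absolutely continuous law has bounded density off a set of small mass. -/
theorem exists_bounded_density {ν : Measure ℝ} [IsProbabilityMeasure ν] (hν : ν ≪ volume)
    {ε : ℝ≥0} (hε : 0 < ε) :
    ∃ (B : Set ℝ) (M : ℕ), MeasurableSet B ∧ 1 ≤ M ∧ ν Bᶜ ≤ ε ∧
      ∀ s, MeasurableSet s → ν.restrict B s ≤ M * volume s := by
  set f := ν.rnDeriv volume with hf
  have hfm : Measurable f := Measure.measurable_rnDeriv _ _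
  obtain ⟨n, hn⟩ := exists_measure_le_of_antitone (μ := ν) (s := fun n : ℕ => {x | f x ≤ n}ᶜ)
    (fun n => (measurableSet_le hfm measurable_const).compl)
    (fun m n hmn => Set.compl_subset_compl.2 fun x (hx : f x ≤ m) =>
      hx.trans (by exact_mod_cast hmn))
    (by
      refine measure_mono_null (t := {x | f x < ∞}ᶜ) (fun x hx hlt => ?_)
        (hν (Measure.rnDeriv_lt_top ν volume))
      obtain ⟨n, hn⟩ := ENNReal.exists_nat_gt (ne_of_lt hlt)
      exact Set.mem_iInter.1 hx n hn.le) hε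
  have hB : MeasurableSet {x | f x ≤ n} := measurableSet_le hfm measurable_const
  refine ⟨{x | f x ≤ n}, n + 1, hB, by omega, hn, fun s hs => ?_⟩
  rw [Measure.restrict_apply hs]
  conv_lhs => rw [← Measure.withDensity_rnDeriv_eq ν volume hν]
  rw [withDensity_apply _ (hs.inter hB)]
  calc ∫⁻ x in s ∩ {x | f x ≤ n}, f x
      ≤ ∫⁻ _ in s ∩ {x | f x ≤ n}, (n : ℝ≥0∞) :=
        setLIntegral_mono' (hs.inter hB) fun x hx => hx.2
    _ ≤ ((n + 1 : ℕ) : ℝ≥0∞) * volume s := by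
        rw [setLIntegral_const]
        gcongr
        · omega
        · exact Set.inter_subset_left

theorem volume_floor_preimage_le {k : ℕ} (hk : 1 ≤ k) (j : ℤ) :
    volume ((fun x : ℝ => ⌊(k : ℝ) * x⌋) ⁻¹' {j}) ≤ ENNReal.ofReal (1 / k) := by
  have hk' : (0 : ℝ) < k := by exact_mod_cast hk
  refine (measure_mono (t := Set.Ico ((j : ℝ) / k) ((j + 1 : ℝ) / k)) fun x hx => ?_).trans ?_
  · have h := Int.floor_eq_iff.1 hx
    exact ⟨(div_le_iff₀' hk').2 h.1, (lt_div_iff₀' hk').2 h.2⟩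
  · rw [Real.volume_Ico, ← sub_div]
    simp

variable {ν νd νc : Measure ℝ} [IsProbabilityMeasure νd] [IsProbabilityMeasure νc] {α : ℝ≥0}

/-- Finitely many atoms carry all but `ε` of the discrete law and have entropy bounded independently
of `k`. The rest has mass at most `α + ε`, and refining costs at most that mass times `log k`. -/
theorem quantEntropy_mixture_le {S : Set ℝ} (hS : S.Countable) (hd : νd Sᶜ = 0)
    (hν : ν = (1 - α) • νd + α • νc) (hprob : IsProbabilityMeasure ν)
    (hfin : quantEntropy ν id 1 < ∞) {ε : ℝ≥0} (hε : 0 < ε) :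
    ∃ C : ℝ≥0, ∀ k : ℕ, 1 ≤ k →
      quantEntropy ν id k ≤ (α + ε) * ENNReal.ofReal (Real.log k) + C := by
  obtain ⟨F, hF⟩ := exists_finset_compl_le hS hd hε
  have hFm : MeasurableSet (F : Set ℝ) := F.measurableSet
  set μ₁ := (1 - α) • νd.restrict F with hμ₁
  set μ₂ := (1 - α) • νd.restrict (F : Set ℝ)ᶜ + α • νc with hμ₂
  have hsum : ν = μ₁ + μ₂ := by
    rw [hν, hμ₁, hμ₂, ← add_assoc, ← smul_add, Measure.restrict_add_restrict_compl hFm]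
  have hmass : (μ₁ + μ₂) Set.univ ≤ 1 := by rw [← hsum]; exact prob_le_one
  have h1 : μ₁ Set.univ ≤ 1 := (Measure.le_add_right le_rfl Set.univ).trans hmass
  have h2 : μ₂ Set.univ ≤ 1 := (Measure.le_add_left le_rfl Set.univ).trans hmass
  have hle : (((1 - α : ℝ≥0)) : ℝ≥0∞) ≤ 1 := by exact_mod_cast tsub_le_self
  have h2' : μ₂ Set.univ ≤ α + ε := by
    rw [hμ₂, Measure.add_apply, Measure.smul_apply, Measure.smul_apply,
      Measure.restrict_apply MeasurableSet.univ, Set.univ_inter, ENNReal.smul_def,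
      ENNReal.smul_def, smul_eq_mul, smul_eq_mul, measure_univ (μ := νc), mul_one, add_comm]
    gcongr
    exact (mul_le_of_le_one_left' hle).trans hF
  have hid : ∀ k : ℕ, Measurable fun x : ℝ => ⌊(k : ℝ) * id x⌋ :=
    measurable_floor_mul measurable_id
  have hH2 : quantEntropy μ₂ id 1 ≤ quantEntropy ν id 1 + 1 := by
    rw [quantEntropy_eq_floor _ le_rfl, quantEntropy_eq_floor _ le_rfl, hsum, add_comm μ₁]
    exact shannonEntropy_le_add_measure (by rwa [add_comm]) (hid 1)
  have hH1 : ∀ k : ℕ, shannonEntropy μ₁ (fun x : ℝ => ⌊(k : ℝ) * id x⌋) ≤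
      ENNReal.ofReal (Real.log (F.card)) + 1 := by
    intro k
    have hmem : ∀ᵐ x ∂μ₁, ⌊(k : ℝ) * id x⌋ ∈ F.image fun x : ℝ => ⌊(k : ℝ) * id x⌋ := by
      have h : ∀ᵐ x ∂μ₁, x ∈ (F : Set ℝ) :=
        Measure.ae_smul_measure (ae_restrict_mem hFm) _
      exact h.mono fun x hx => Finset.mem_image_of_mem _ hx
    refine (shannonEntropy_le_of_mem_finset h1 (hid k) hmem).trans ?_
    gcongr
    refine (mul_le_of_le_one_left' h1).trans (ENNReal.ofReal_le_ofReal ?_)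
    rcases Nat.eq_zero_or_pos (F.image fun x : ℝ => ⌊(k : ℝ) * id x⌋).card with h0 | h0
    · rw [h0, Nat.cast_zero, Real.log_zero]
      exact Real.log_natCast_nonneg _
    · exact Real.log_le_log (by exact_mod_cast h0) (by exact_mod_cast Finset.card_image_le)
  refine ⟨(ENNReal.ofReal (Real.log F.card) + 1 + (quantEntropy ν id 1 + 1 + 1)).toNNReal,
    fun k hk => ?_⟩
  rw [ENNReal.coe_toNNReal (by simp [hfin.ne])]
  calc quantEntropy ν id k ≤ quantEntropy μ₁ id k + quantEntropy μ₂ id k := by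
        rw [hsum]
        exact shannonEntropy_add_measure_le h1 h2 _
    _ ≤ (ENNReal.ofReal (Real.log F.card) + 1) + ((quantEntropy ν id 1 + 1) +
          ((α + ε) * ENNReal.ofReal (Real.log k) + 1)) := by
        gcongr
        · rw [quantEntropy_eq_floor _ hk]
          exact hH1 k
        · refine (quantEntropy_le h2 measurable_id hk).trans ?_
          gcongr
    _ = _ := by ring

/-- Where the density of `νc` is at most `M`, a cell has mass at most `M / k`, so this part has
entropy at least its mass times `log k - log M`. Its mass is at least `α - ε`, and restoring the
rest of the law costs at most a constant. -/
theorem le_quantEntropy_mixture (hα : α ≤ 1) (hc : νc ≪ volume)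
    (hν : ν = (1 - α) • νd + α • νc) (hprob : IsProbabilityMeasure ν) {ε : ℝ≥0} (hε : 0 < ε) :
    ∃ C : ℝ≥0, ∀ k : ℕ, 1 ≤ k → α * ENNReal.ofReal (Real.log k) ≤
      quantEntropy ν id k + ε * ENNReal.ofReal (Real.log k) + C := by
  obtain ⟨B, M, hB, hM, hBε, hbound⟩ := exists_bounded_density hc hε
  set μ₁ := α • νc.restrict B with hμ₁
  set μ₂ := α • νc.restrict Bᶜ + (1 - α) • νd with hμ₂
  have hsum : ν = μ₁ + μ₂ := by
    rw [hν, hμ₁, hμ₂, ← add_assoc, ← smul_add, Measure.restrict_add_restrict_compl hB, add_comm]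
  have hmass : (μ₁ + μ₂) Set.univ ≤ 1 := by rw [← hsum]; exact prob_le_one
  have h1 : μ₁ Set.univ ≤ 1 := (Measure.le_add_right le_rfl Set.univ).trans hmass
  have hα' : (α : ℝ≥0∞) ≤ 1 := by exact_mod_cast hα
  have hαμ : (α : ℝ≥0∞) ≤ μ₁ Set.univ + ε := by
    calc (α : ℝ≥0∞) = α * νc B + α * νc Bᶜ := by
          rw [← mul_add, measure_add_measure_compl hB, measure_univ, mul_one]
      _ ≤ μ₁ Set.univ + ε := by
          rw [hμ₁, Measure.smul_apply, Measure.restrict_apply MeasurableSet.univ, Set.univ_inter,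
            ENNReal.smul_def, smul_eq_mul]
          gcongr
          exact (mul_le_of_le_one_left' hα').trans hBε
  have hid : ∀ k : ℕ, Measurable fun x : ℝ => ⌊(k : ℝ) * id x⌋ :=
    measurable_floor_mul measurable_id
  refine ⟨(1 + ENNReal.ofReal (Real.log M)).toNNReal, fun k hk => ?_⟩
  rw [ENNReal.coe_toNNReal (by simp)]
  have hk' : (0 : ℝ) < k := by exact_mod_cast hk
  have hM' : (0 : ℝ) < M := by exact_mod_cast hM
  have hcell : ∀ j : ℤ, μ₁.real ((fun x : ℝ => ⌊(k : ℝ) * id x⌋) ⁻¹' {j}) ≤ M / k := by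
    intro j
    refine ENNReal.toReal_le_of_le_ofReal (by positivity) ?_
    rw [hμ₁, Measure.smul_apply, ENNReal.smul_def, smul_eq_mul]
    refine (mul_le_of_le_one_left' hα').trans
      ((hbound _ (hid k (measurableSet_singleton j))).trans ?_)
    rw [div_eq_mul_one_div, ENNReal.ofReal_mul hM'.le, ENNReal.ofReal_natCast]
    gcongr
    exact volume_floor_preimage_le hk j
  have hlog : ENNReal.ofReal (Real.log k) ≤
      ENNReal.ofReal (-Real.log (M / k)) + ENNReal.ofReal (Real.log M) := by
    refine le_trans (ENNReal.ofReal_le_ofReal ?_) ENNReal.ofReal_add_le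
    rw [Real.log_div hM'.ne' hk'.ne']
    linarith
  calc α * ENNReal.ofReal (Real.log k)
      ≤ (μ₁ Set.univ + ε) * ENNReal.ofReal (Real.log k) := by gcongr
    _ = μ₁ Set.univ * ENNReal.ofReal (Real.log k) + ε * ENNReal.ofReal (Real.log k) := add_mul ..
    _ ≤ μ₁ Set.univ * (ENNReal.ofReal (-Real.log (M / k)) + ENNReal.ofReal (Real.log M))
          + ε * ENNReal.ofReal (Real.log k) := by gcongr
    _ ≤ (shannonEntropy μ₁ (fun x : ℝ => ⌊(k : ℝ) * id x⌋) + ENNReal.ofReal (Real.log M))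
          + ε * ENNReal.ofReal (Real.log k) := by
        rw [mul_add]
        gcongr
        · exact mul_neg_log_le_shannonEntropy h1 (hid k) hcell
        · exact mul_le_of_le_one_left' h1
    _ ≤ ((quantEntropy ν id k + 1) + ENNReal.ofReal (Real.log M))
          + ε * ENNReal.ofReal (Real.log k) := by
        gcongr
        rw [quantEntropy_eq_floor _ hk, hsum]
        exact shannonEntropy_le_add_measure hmass (hid k)
    _ = _ := by ring

theorem tendsto_ofReal_log_atTop :
    Tendsto (fun k : ℕ => ENNReal.ofReal (Real.log k)) atTop (𝓝 ∞) :=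
  ENNReal.tendsto_ofReal_nhds_top.2 (Real.tendsto_log_atTop.comp tendsto_natCast_atTop_atTop)

/-- Rényi's theorem for discrete-continuous laws. -/
theorem IsDiscreteContinuous.tendsto_quantEntropy_div {ν : Measure ℝ} [IsProbabilityMeasure ν]
    {α : ℝ≥0} (h : IsDiscreteContinuous ν α) (hfin : quantEntropy ν id 1 < ∞) :
    HasInfoDim ν id α := by
  obtain ⟨hα, νd, νc, _, _, ⟨S, hS, hd⟩, hc, hν⟩ := h
  refine (ENNReal.tendsto_nhds (by simp)).2 fun ε hε => ?_
  -- Here `ε` may be infinite, so a finite `δ` below it is used: half pays for the mass defect in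
  -- the splittings, half absorbs the constants once `log k` is large.
  obtain ⟨δ, hδ0, hδ⟩ := ENNReal.lt_iff_exists_nnreal_btwn.1 hε
  have hδ0' : 0 < δ / 2 := by
    have : 0 < δ := by exact_mod_cast hδ0
    positivity
  obtain ⟨C₁, h₁⟩ := quantEntropy_mixture_le hS hd hν ‹_› hfin hδ0'
  obtain ⟨C₂, h₂⟩ := le_quantEntropy_mixture hα hc hν ‹_› hδ0'
  have hbig : ∀ C : ℝ≥0, ∀ᶠ k : ℕ in atTop,
      (C : ℝ≥0∞) ≤ (δ / 2 : ℝ≥0) * ENNReal.ofReal (Real.log k) := fun C => by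
    have ht : Tendsto (fun k : ℕ => ((δ / 2 : ℝ≥0) : ℝ≥0∞) * ENNReal.ofReal (Real.log k)) atTop
        (𝓝 (((δ / 2 : ℝ≥0) : ℝ≥0∞) * ∞)) := ENNReal.Tendsto.const_mul tendsto_ofReal_log_atTop
      (Or.inl ENNReal.top_ne_zero)
    rw [ENNReal.mul_top (by exact_mod_cast hδ0'.ne')] at ht
    exact (ht.eventually (lt_mem_nhds ENNReal.coe_lt_top)).mono fun k hk => hk.le
  filter_upwards [eventually_ge_atTop 2, hbig C₁, hbig C₂] with k hk hC₁ hC₂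
  have hL0 : ENNReal.ofReal (Real.log k) ≠ 0 := by
    rw [Ne, ENNReal.ofReal_eq_zero, not_le]
    exact Real.log_pos (by exact_mod_cast hk)
  have hδeq : ((δ / 2 : ℝ≥0) : ℝ≥0∞) + (δ / 2 : ℝ≥0) = δ := by
    rw [← ENNReal.coe_add, add_halves]
  have h₁' := h₁ k (by omega)
  have h₂' := h₂ k (by omega)
  have hL : ENNReal.ofReal (Real.log k) ≠ ∞ := ENNReal.ofReal_ne_top
  generalize ENNReal.ofReal (Real.log k) = L at *
  have hle1 : quantEntropy ν id k ≤ (α + δ) * L := by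
    refine h₁'.trans ((add_le_add le_rfl hC₁).trans_eq ?_)
    rw [← add_mul, add_assoc, hδeq]
  have hle2 : α * L ≤ quantEntropy ν id k + δ * L := by
    refine h₂'.trans ((add_le_add le_rfl hC₂).trans_eq ?_)
    rw [add_assoc, ← add_mul, hδeq]
  constructor
  · rw [tsub_le_iff_right]
    refine le_trans ?_ (add_le_add le_rfl hδ.le)
    refine ((ENNReal.le_div_iff_mul_le (.inl hL0) (.inl hL)).2 hle2).trans_eq ?_
    rw [ENNReal.add_div, ENNReal.mul_div_cancel_right hL0 hL]
  · refine le_trans ?_ (add_le_add le_rfl hδ.le)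
    exact ENNReal.div_le_of_le_mul hle1

end DiscreteContinuous

/-! ### The two iterated limits, deduced from the uniform bounds. -/

section Limits

theorem tendsto_div_natCast {c : ℝ≥0∞} (hc : c ≠ ∞) :
    Tendsto (fun n : ℕ => c / (n : ℝ≥0∞)) atTop (𝓝 0) := by
  have h := ENNReal.Tendsto.const_mul ENNReal.tendsto_inv_nat_nhds_zero (Or.inr hc)
  rwa [mul_zero] at h

theorem natCast_mul_div_eventuallyEq (a : ℝ≥0∞) :
    (fun n : ℕ => (n : ℝ≥0∞) * a / n) =ᶠ[atTop] fun _ => a := by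
  filter_upwards [eventually_gt_atTop 0] with n hn
  rw [mul_comm, ENNReal.mul_div_cancel_right (by exact_mod_cast hn.ne') (ENNReal.natCast_ne_top n)]

theorem liminf_limsup_mem_of_tendsto {u : ℕ → ℝ≥0∞} {v w : ℕ → ℝ≥0∞} {a b : ℝ≥0∞}
    (hv : Tendsto v atTop (𝓝 a)) (hw : Tendsto w atTop (𝓝 b)) (h1 : ∀ᶠ n in atTop, v n ≤ u n)
    (h2 : ∀ᶠ n in atTop, u n ≤ w n) :
    a ≤ liminf u atTop ∧ limsup u atTop ≤ b :=
  ⟨hv.liminf_eq.symm.trans_le (liminf_le_liminf h1), (limsup_le_limsup h2).trans_eq hw.limsup_eq⟩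

theorem tendsto_liminf_limsup_of_bounds {f : ℕ → ℕ → ℝ≥0∞} {v w : ℕ → ℝ≥0∞} {c : ℕ → ℝ≥0∞}
    {a : ℝ≥0∞} (hv : Tendsto (fun n => v n / c n) atTop (𝓝 a))
    (hw : Tendsto (fun n => w n / c n) atTop (𝓝 a))
    (h : ∀ᶠ n in atTop, v n ≤ liminf (f n) atTop ∧ limsup (f n) atTop ≤ w n) :
    Tendsto (fun n => limsup (f n) atTop / c n) atTop (𝓝 a) ∧
    Tendsto (fun n => liminf (f n) atTop / c n) atTop (𝓝 a) := by
  have hle : ∀ n, liminf (f n) atTop ≤ limsup (f n) atTop := fun n => liminf_le_limsup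
  constructor
  · refine tendsto_of_tendsto_of_tendsto_of_le_of_le' hv hw ?_ ?_
    · filter_upwards [h] with n hn
      exact ENNReal.div_le_div_right (hn.1.trans (hle n)) _
    · filter_upwards [h] with n hn
      exact ENNReal.div_le_div_right hn.2 _
  · refine tendsto_of_tendsto_of_tendsto_of_le_of_le' hv hw ?_ ?_
    · filter_upwards [h] with n hn
      exact ENNReal.div_le_div_right hn.1 _
    · filter_upwards [h] with n hn
      exact ENNReal.div_le_div_right ((hle n).trans hn.2) _

variable {H : ℕ → ℕ → ℝ≥0∞} {h L : ℕ → ℝ≥0∞} {α C D : ℝ≥0} {p q : ℕ}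

/-- For fixed `n`, dividing by `L k` kills `n C` and `D` and turns the boundary term into the finite
constant `p + q α`, which division by `n` then removes. -/
theorem tendsto_blockAverage_of_bounds (hL : Tendsto L atTop (𝓝 ∞))
    (hh : Tendsto (fun k => h k / L k) atTop (𝓝 α)) (hLtop : ∀ k, L k ≠ ∞)
    (hup : ∀ᶠ k in atTop, ∀ n : ℕ, H n k ≤ n * (h k + C) + (D + p * L k + q * h k))
    (hlow : ∀ᶠ k in atTop, ∀ n : ℕ, n * h k ≤ H n k + n * C + (D + p * L k + q * h k)) :
    Tendsto (fun n : ℕ => limsup (fun k => H n k / L k) atTop / (n : ℝ≥0∞)) atTop (𝓝 α) ∧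
    Tendsto (fun n : ℕ => liminf (fun k => H n k / L k) atTop / (n : ℝ≥0∞)) atTop (𝓝 α) := by
  have hL0 : ∀ᶠ k in atTop, L k ≠ 0 :=
    (hL.eventually (lt_mem_nhds ENNReal.zero_lt_top)).mono fun k hk => hk.ne'
  have hconst : ∀ c : ℝ≥0, Tendsto (fun k => (c : ℝ≥0∞) / L k) atTop (𝓝 0) := fun c => by
    have := ENNReal.Tendsto.const_div (m := L) (a := c) hL (Or.inr ENNReal.coe_ne_top)
    rwa [ENNReal.div_top] at this
  have hpL : Tendsto (fun k => (p : ℝ≥0∞) * L k / L k) atTop (𝓝 p) :=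
    tendsto_const_nhds.congr' (by
      filter_upwards [hL0] with k hk
      rw [ENNReal.mul_div_cancel_right hk (hLtop k)])
  have hE : Tendsto (fun k => (D + p * L k + q * h k) / L k) atTop (𝓝 (0 + p + q * α)) := by
    simp_rw [ENNReal.add_div, mul_div_assoc (q : ℝ≥0∞)]
    exact ((hconst D).add hpL).add (ENNReal.Tendsto.const_mul hh (Or.inr (by simp)))
  have hEtop : (0 + p + q * α : ℝ≥0∞) ≠ ∞ := by
    simp [ENNReal.mul_eq_top]
  generalize (0 + p + q * α : ℝ≥0∞) = e at *
  refine tendsto_liminf_limsup_of_bounds (v := fun n => n * α - e) (w := fun n => n * α + e)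
    ?_ ?_ (Eventually.of_forall fun n => ?_)
  · have h1 : Tendsto (fun n : ℕ => α - e / (n : ℝ≥0∞)) atTop (𝓝 (α - 0)) :=
      ENNReal.Tendsto.sub tendsto_const_nhds (tendsto_div_natCast hEtop)
        (Or.inl ENNReal.coe_ne_top)
    rw [tsub_zero] at h1
    refine h1.congr' ?_
    filter_upwards [natCast_mul_div_eventuallyEq α, eventually_gt_atTop 0] with n hn hn0
    rw [ENNReal.sub_div (fun _ _ => by exact_mod_cast hn0.ne'), hn]
  · have h1 : Tendsto (fun n : ℕ => α + e / (n : ℝ≥0∞)) atTop (𝓝 (α + 0)) :=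
      tendsto_const_nhds.add (tendsto_div_natCast hEtop)
    rw [add_zero] at h1
    refine h1.congr' ?_
    filter_upwards [natCast_mul_div_eventuallyEq α] with n hn
    rw [ENNReal.add_div, hn]
  · have hn : Tendsto (fun k => (n : ℝ≥0∞) * (h k / L k)) atTop (𝓝 (n * α)) :=
      ENNReal.Tendsto.const_mul hh (Or.inr (ENNReal.natCast_ne_top n))
    have hC : Tendsto (fun k => (n : ℝ≥0∞) * (C / L k)) atTop (𝓝 (n * 0)) :=
      ENNReal.Tendsto.const_mul (hconst C) (Or.inr (ENNReal.natCast_ne_top n))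
    rw [mul_zero] at hC
    refine liminf_limsup_mem_of_tendsto
      (v := fun k => n * (h k / L k) - (n * (C / L k) + (D + p * L k + q * h k) / L k))
      (w := fun k => n * (h k / L k) + (n * (C / L k) + (D + p * L k + q * h k) / L k)) ?_ ?_ ?_ ?_
    · have := ENNReal.Tendsto.sub hn (hC.add hE)
        (Or.inl (ENNReal.mul_ne_top (ENNReal.natCast_ne_top n) ENNReal.coe_ne_top))
      rwa [zero_add] at this
    · have := hn.add (hC.add hE)
      rwa [zero_add] at this
    · filter_upwards [hlow] with k hk
      rw [tsub_le_iff_right]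
      refine (le_of_eq ?_).trans ((ENNReal.div_le_div_right (hk n) (L k)).trans_eq ?_)
      · rw [mul_div_assoc]
      · rw [ENNReal.add_div, ENNReal.add_div, mul_div_assoc, add_assoc]
    · filter_upwards [hup] with k hk
      refine (ENNReal.div_le_div_right (hk n) (L k)).trans_eq ?_
      rw [ENNReal.add_div, mul_add, ENNReal.add_div, mul_div_assoc, mul_div_assoc, add_assoc]

/-- For fixed large `k` the boundary term is finite and vanishes after division by `n`; only the
rounding cost `C` per step survives, and `L k` removes it. -/
theorem tendsto_rate_of_bounds (hL : Tendsto L atTop (𝓝 ∞))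
    (hh : Tendsto (fun k => h k / L k) atTop (𝓝 α)) (hLtop : ∀ k, L k ≠ ∞)
    (hup : ∀ᶠ k in atTop, ∀ n : ℕ, H n k ≤ n * (h k + C) + (D + p * L k + q * h k))
    (hlow : ∀ᶠ k in atTop, ∀ n : ℕ, n * h k ≤ H n k + n * C + (D + p * L k + q * h k)) :
    Tendsto (fun k : ℕ => limsup (fun n : ℕ => H n k / (n : ℝ≥0∞)) atTop / L k) atTop (𝓝 α) ∧
    Tendsto (fun k : ℕ => liminf (fun n : ℕ => H n k / (n : ℝ≥0∞)) atTop / L k) atTop (𝓝 α) := by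
  have hL0 : ∀ᶠ k in atTop, L k ≠ 0 :=
    (hL.eventually (lt_mem_nhds ENNReal.zero_lt_top)).mono fun k hk => hk.ne'
  have hC : Tendsto (fun k => (C : ℝ≥0∞) / L k) atTop (𝓝 0) := by
    have := ENNReal.Tendsto.const_div (m := L) (a := C) hL (Or.inr ENNReal.coe_ne_top)
    rwa [ENNReal.div_top] at this
  -- A finite limit of the ratios forces finite noise entropy for large `k`, without which the
  -- boundary term could not be divided away.
  have hhtop : ∀ᶠ k in atTop, h k ≠ ∞ := by
    filter_upwards [hh.eventually (gt_mem_nhds ENNReal.coe_lt_top)] with k hk hk'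
    rw [hk', ENNReal.top_div_of_ne_top (hLtop k)] at hk
    exact lt_irrefl _ hk
  refine tendsto_liminf_limsup_of_bounds (v := fun k => h k - C) (w := fun k => h k + C) ?_ ?_ ?_
  · have h1 := ENNReal.Tendsto.sub hh hC (Or.inl ENNReal.coe_ne_top)
    rw [tsub_zero] at h1
    refine h1.congr' ?_
    filter_upwards [hL0] with k hk
    rw [ENNReal.sub_div (fun _ _ => hk)]
  · have h1 := hh.add hC
    rw [add_zero] at h1
    refine h1.congr fun k => ?_
    rw [ENNReal.add_div]
  · filter_upwards [hhtop, hup, hlow] with k hk hu hl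
    have hE : (D + p * L k + q * h k : ℝ≥0∞) ≠ ∞ := by
      simp [ENNReal.mul_eq_top, hk, hLtop k]
    generalize (D + p * L k + q * h k : ℝ≥0∞) = E at *
    have hEn := tendsto_div_natCast hE
    refine liminf_limsup_mem_of_tendsto (v := fun n : ℕ => h k - (C + E / (n : ℝ≥0∞)))
      (w := fun n : ℕ => h k + C + E / (n : ℝ≥0∞)) ?_ ?_ ?_ ?_
    · have := ENNReal.Tendsto.sub (tendsto_const_nhds (x := h k))
        ((tendsto_const_nhds (x := (C : ℝ≥0∞))).add hEn) (Or.inl hk)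
      rwa [add_zero] at this
    · have := (tendsto_const_nhds (x := h k + (C : ℝ≥0∞))).add hEn
      rwa [add_zero] at this
    · filter_upwards [natCast_mul_div_eventuallyEq (h k), natCast_mul_div_eventuallyEq C]
        with n hn1 hn2
      rw [tsub_le_iff_right, ← hn1]
      refine (ENNReal.div_le_div_right (hl n) n).trans_eq ?_
      rw [ENNReal.add_div, ENNReal.add_div, hn2, add_assoc]
    · filter_upwards [natCast_mul_div_eventuallyEq (h k + C)] with n hn1
      refine (ENNReal.div_le_div_right (hu n) n).trans_eq ?_
      rw [ENNReal.add_div, hn1]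

end Limits

theorem mainTheorem2 {Ω : Type*} [MeasurableSpace Ω] (μ : Measure Ω) [IsProbabilityMeasure μ]
    {p q : ℕ} (φ : Fin p → ℝ) (θ : Fin q → ℝ) (ξ X : ℤ → Ω → ℝ)
    (hX : IsARMA μ φ θ ξ X)
    (hfin : ∀ t : ℤ, quantEntropy μ (X t) 1 < ∞)
    (α : ℝ≥0)
    (hα : HasInfoDim μ (ξ 0) α ∨
      (quantEntropy μ (ξ 0) 1 < ∞ ∧ IsDiscreteContinuous (μ.map (ξ 0)) α)) :
    HasBlockAverageInfoDim μ X α ∧ HasInfoDimRate μ X α ∧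
      (IsStrictlyStationary μ X → ∀ k : ℕ, 1 ≤ k →
        ∃ h : ℝ≥0, Tendsto (fun n : ℕ => blockEntropy μ X n k / (n : ℝ≥0∞)) atTop
          (𝓝 (h : ℝ≥0∞))) := by
  -- Rényi's theorem, applied to the law of `ξ 0`, reduces the second alternative to the first.
  have hdim : HasInfoDim μ (ξ 0) α := by
    rcases hα with h | ⟨hfin0, h⟩
    · exact h
    · have hm := hX.measurable_noise 0
      have := Measure.isProbabilityMeasure_map (μ := μ) hm.aemeasurable
      have h2 := h.tendsto_quantEntropy_div (by rwa [quantEntropy_map hm])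
      unfold HasInfoDim at h2 ⊢
      simpa only [quantEntropy_map hm] using h2
  obtain ⟨C, D, hCD⟩ := hX.blockEntropy_bounds hfin
  have hup := (eventually_ge_atTop 1).mono fun k hk n => (hCD k hk n).1
  have hlow := (eventually_ge_atTop 1).mono fun k hk n => (hCD k hk n).2
  exact ⟨tendsto_blockAverage_of_bounds tendsto_ofReal_log_atTop hdim
      (fun _ => ENNReal.ofReal_ne_top) hup hlow,
    tendsto_rate_of_bounds tendsto_ofReal_log_atTop hdim
      (fun _ => ENNReal.ofReal_ne_top) hup hlow,
    fun hs k hk => hs.exists_tendsto_blockEntropy_div hX.measurable_process hfin hk⟩
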